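/- **Convergence of the involutes iteration.** Let $\mathcal P$ be a normed plane ($\mathbb R^2$ with a norm) whose unit circle is smooth and quadratically convex, and let $p(\theta)$, $p(\theta+\pi)=-p(\theta)$, be the smooth parametrization of the unit circle by the angle $\theta$ of its tangent with a fixed direction, with $p'(\theta)$ a positive multiple of the unit vector at angle $\theta$ from that direction. Let $[\cdot,\cdot]$ be the determinant and $q=p'/[p,p']$ the dual parametrization. On $C^0(S^1)$ (continuous $2\pi$-periodic functions) use $\langle h_1,h_2\rangle=\int_0^{2\pi}h_1h_2[p,p']\,d\theta$, let $L_0$ be the orthogonal complement of the constants, and put $$Th=-\frac1{[p,p']}\Big(\frac{h'}{[q,q']}\Big)'.$$ A $2\pi$-periodic eigenfunction $u\ne0$ of $T$ has *index* $k$ if it has exactly $2k$ zeros in a period. Let $C_0\subset L_0$ be the closure, in the norm of $\langle\cdot,\cdot\rangle$ and within $L_0$, of the span of the eigenfunctions of index $k\ge2$. A *closed curve* is here a smooth $2\pi$-periodic $\gamma$ with $\gamma'(\theta)$ parallel to $p'(\theta)$; its support function is $h=[\gamma,q]$, its dual length is $\int_0^{2\pi}[p,\gamma']\,d\theta$. The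 curve with support function $g$ is $\gamma_g=g\,p+\frac{g'}{[q,q']}\,q$. The double evolute of $\gamma$ is $\gamma-rp-sq$, where $\gamma'=rp'$ and $(\gamma-rp)'=sq'$. Then: 1. $T$ is a bijection from $L_0\cap C^2$ onto $L_0$. Let $S$ be its inverse. For every $C^1$ function $h\in L_0$, the double evolute of $\gamma_{Sh}$ is $\gamma_h$; so $S$ is the (double) involute operator on support functions. 2. If $\gamma$ is a closed curve with support function $h$, then $\gamma=\gamma_h$. If moreover $\gamma$ has zero dual length, there is exactly one $v\in\mathbb R^2$ such that the support function of the translate $\gamma-v$ lies in $C_0$. 3. Every eigenvalue of $T$ belonging to a periodic eigenfunction of index $k\ge2$ is greater than $1$. 4. For every $h\in C_0$, the iterated involutes converge to $0$: $S^nh\to0$ uniformly, and the curves $\gamma_{S^nh}$ converge to $0$ uniformly. 5. For every $h\in C_0$, $h\neq0$, there are $k\ge2$, $\lambda$ and an eigenfunction $u\ne0$ of index $k$ with eigenvalue $\lambda$ such that: $u$ is the orthogonal projection of $h$ onto the $\lambda$-eigenspace; $(k,\lambda)$ is the lowest nonzero mode of $h$, that is, if $v$ is a periodic eigenfunction of index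 $j$ with eigenvalue $\mu$ and $\langle h,v\rangle\ne0$, then $k\le j$ and $\lambda\le\mu$; the curve $\gamma_u$ is a cycloid, its double evolute being $\lambda\gamma_u$; and $\lambda^nS^nh\to u$ uniformly and $\lambda^n\gamma_{S^nh}\to\gamma_u$ uniformly. -/

import Mathlib

open Real Set Filter Topology

noncomputable section

namespace NormedPlane

/-- The determinant `[x, y]` of a pair of vectors of the plane. -/
def det (x y : ℝ × ℝ) : ℝ := x.1 * y.2 - x.2 * y.1

/-- `p` parametrizes the unit circle of the norm `N` by the angle which the tangent makes with a
fixed direction (the direction of polar angle `α`). The speed `ρ` is the Euclidean radius of curvature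
of the unit circle, so smoothness of `p` and `0 < ρ` say that the unit circle is smooth and
quadratically convex. -/
structure IsUnitCircleParam (N : Seminorm ℝ (ℝ × ℝ)) (α : ℝ) (p : ℝ → ℝ × ℝ) : Prop where
  definite : ∀ x, N x = 0 → x = 0
  smooth : ContDiff ℝ (⊤ : ℕ∞) p
  range_eq : range p = {x | N x = 1}
  antiperiodic : ∀ θ, p (θ + π) = -p θ
  tangent_angle : ∀ θ, ∃ ρ : ℝ, 0 < ρ ∧ deriv p θ = ρ • (cos (θ + α), sin (θ + α))

/-- The weight `[p, p']`. -/
def wt (p : ℝ → ℝ × ℝ) (θ : ℝ) : ℝ := det (p θ) (deriv p θ)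

/-- The dual parametrization `q = p' / [p, p']`. -/
def dual (p : ℝ → ℝ × ℝ) (θ : ℝ) : ℝ × ℝ := (wt p θ)⁻¹ • deriv p θ

/-- The weight `[q, q']`. -/
def dualWt (p : ℝ → ℝ × ℝ) (θ : ℝ) : ℝ := det (dual p θ) (deriv (dual p) θ)

/-! ### Curves -/

/-- A closed smooth front parametrized by the angle of its tangent lines: at the parameter `θ` its
tangent line is parallel to `p' θ`. -/
structure IsHedgehog (p γ : ℝ → ℝ × ℝ) : Prop where
  smooth : ContDiff ℝ (⊤ : ℕ∞) γ
  closed : Function.Periodic γ (2 * π)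
  tangent : ∀ θ, det (deriv γ θ) (deriv p θ) = 0

/-- The support function `[γ, q]`. -/
def support (p γ : ℝ → ℝ × ℝ) (θ : ℝ) : ℝ := det (γ θ) (dual p θ)

/-- The curve `g p + (g' / [q, q']) q`, whose support function is `g`. -/
def curveOf (p : ℝ → ℝ × ℝ) (g : ℝ → ℝ) (θ : ℝ) : ℝ × ℝ :=
  g θ • p θ + (deriv g θ / dualWt p θ) • dual p θ

/-- The signed length of `γ` in the dual norm: `γ' = [p, γ'] q`, and `q` runs on the dual unit
circle. -/
def dualLength (p γ : ℝ → ℝ × ℝ) : ℝ := ∫ θ in (0 : ℝ)..(2 * π), det (p θ) (deriv γ θ)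

/-- `η` is the double evolute of `γ`, equivalently `γ` is a (double) involute of `η`: with the
curvature radius `r` of `γ`, defined by `γ' = r p'`, the evolute is `δ = γ - r p`; with the
curvature radius `s` of `δ`, defined by `δ' = s q'`, its evolute is `η = δ - s q`. -/
def IsDoubleEvolute (p γ η : ℝ → ℝ × ℝ) : Prop :=
  ∃ r s : ℝ → ℝ,
    (∀ θ, HasDerivAt γ (r θ • deriv p θ) θ) ∧
    (∀ θ, HasDerivAt (fun t => γ t - r t • p t) (s θ • deriv (dual p) θ) θ) ∧
    (∀ θ, η θ = γ θ - r θ • p θ - s θ • dual p θ)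

/-! ### Function spaces and the operators `T`, `S` -/

/-- The inner product with weight `[p, p']`. -/
def ip (p : ℝ → ℝ × ℝ) (h₁ h₂ : ℝ → ℝ) : ℝ :=
  ∫ θ in (0 : ℝ)..(2 * π), h₁ θ * h₂ θ * wt p θ

/-- The space `L₀` of continuous functions on the circle (continuous `2π`-periodic functions)
that are orthogonal to the constants. -/
def L0 (p : ℝ → ℝ × ℝ) : Set (ℝ → ℝ) :=
  {h | Continuous h ∧ Function.Periodic h (2 * π) ∧
    ∫ θ in (0 : ℝ)..(2 * π), h θ * wt p θ = 0}

/-- `T h = -(1 / [p, p']) (h' / [q, q'])'`. -/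
def T (p : ℝ → ℝ × ℝ) (h : ℝ → ℝ) : ℝ → ℝ :=
  fun θ => -((wt p θ)⁻¹ * deriv (fun t => deriv h t / dualWt p t) θ)

/-- The twice continuously differentiable functions in `L₀`. -/
def D0 (p : ℝ → ℝ × ℝ) : Set (ℝ → ℝ) := {g | g ∈ L0 p ∧ ContDiff ℝ 2 g}

/-- The inverse `S` of `T`: for `h` in `L₀`, `S h` is the `g` in `D0 p` with `T g = h`. -/
def S (p : ℝ → ℝ × ℝ) : (ℝ → ℝ) → (ℝ → ℝ) := Function.invFunOn (T p) (D0 p)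

/-- `u` is a `2π`-periodic eigenfunction of `T` for the eigenvalue `lam`, of index `k`, that is,
with `2 * k` zeros in a period. -/
structure IsMode (p : ℝ → ℝ × ℝ) (k : ℕ) (lam : ℝ) (u : ℝ → ℝ) : Prop where
  contDiff : ContDiff ℝ 2 u
  periodic : Function.Periodic u (2 * π)
  ne_zero : u ≠ 0
  eigen : T p u = lam • u
  index : {θ | θ ∈ Ico 0 (2 * π) ∧ u θ = 0}.encard = 2 * k

/-- The subspace `C₀` of `L₀` generated by the eigenfunctions of index at least two: the closure
of their linear span for the norm of `ip p`. -/
def C0 (p : ℝ → ℝ × ℝ) : Set (ℝ → ℝ) :=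
  {h | h ∈ L0 p ∧ ∀ ε > 0, ∃ g ∈ Submodule.span ℝ {u | ∃ k lam, 2 ≤ k ∧ IsMode p k lam u},
    ip p (h - g) (h - g) < ε}

end NormedPlane

end

/-! The equation `T g = h` is a periodic Sturm-Liouville problem, written as the first-order system
`g' = [q,q'] m`, `m' = -[p,p'] h` for `g` and its flux `m` (`IsSolution`). It is solved by
integrating twice, which gives the bijectivity of `T`. The constancy of the Wronskian defect over a
period makes `S` symmetric for `ip p`. Bounds of `g` and `m` by the norm of `h`, with Arzela-Ascoli,
make `S` compact on `L0`. The space `L0` is not complete, so the spectral theorem is applied in its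
completion and brought back (`apply_mem_closure_span_eigenvectors`).

The eigenvalue 1 marks the borderline. Its eigenfunctions are exactly the support functions of
points (`isSolution_det_dual`, `exists_eq_det_dual`), and some of these have at most two zeros in a
period. By Sturm comparison the number of zeros is monotone in the eigenvalue (`zeroCount_le`), so
index at least two forces an eigenvalue above 1. Conversely, an eigenvalue other than 0 and 1 forces
index at least two (`two_le_index`). Hence removing the support function of a suitable point, that
is, translating the curve, is what is needed to land in `C0`.

On `C0` the iteration of `S` is the power method: after rescaling, `S^n h` tends in norm to the
projection of `h` onto the eigenspace of the largest eigenvalue of `S` seen by `h`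
(`exists_dominant_eigenvector`). That eigenvalue is `1 / lam` with `lam` minimal, and Sturm
comparison makes the index minimal as well. One further application of `S` turns norm convergence
into uniform convergence of functions and fluxes, hence of curves (`tendstoUniformly_of_tendsto`).
As `lam > 1`, the unscaled iterates tend to zero. -/

noncomputable section

namespace NormedPlane

/-! ### Compact symmetric operators without completeness, and the power method -/

section CompactSymmetric

variable {E : Type*} [NormedAddCommGroup E] [InnerProductSpace ℝ E] {S : E →L[ℝ] E}

open Module.End
open scoped InnerProductSpace

/-- The range of a compact symmetric operator is contained in the closed span of its eigenvectors
for nonzero eigenvalues; the space need not be complete. -/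
theorem apply_mem_closure_span_eigenvectors (hS : (S : E →ₗ[ℝ] E).IsSymmetric)
    (hc : IsCompactOperator S) (g : E) :
    S g ∈ closure (Submodule.span ℝ {x | ∃ κ : ℝ, κ ≠ 0 ∧ S x = κ • x} : Set E) := by
  set F := Submodule.span ℝ {x | ∃ κ : ℝ, κ ≠ 0 ∧ S x = κ • x}
  let ι : E →L[ℝ] UniformSpace.Completion E := UniformSpace.Completion.toComplL
  have hd : DenseRange ι := UniformSpace.Completion.denseRange_coe
  have hu : IsUniformInducing ι := UniformSpace.Completion.isUniformInducing_coe E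
  have hinj : Function.Injective ι := UniformSpace.Completion.coe_injective E
  have hinner : ∀ x y : E, ⟪ι x, ι y⟫_ℝ = ⟪x, y⟫_ℝ := fun x y => UniformSpace.Completion.inner_coe x y
  have hnorm : ∀ x : E, ‖ι x‖ = ‖x‖ := fun x => UniformSpace.Completion.norm_coe x
  let R : UniformSpace.Completion E →L[ℝ] UniformSpace.Completion E := (ι.comp S).extend ι
  have hR : ∀ x, R (ι x) = ι (S x) := fun x => (ι.comp S).extend_eq hd hu x
  obtain ⟨K, hK, hKS⟩ := IsCompactOperator.image_ball_subset_compact (f := (S : E →ₗ[ℝ] E)) hc 1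
  -- The image of `K` is compact, hence closed in the completion. So the extension `R` is compact
  -- and, after scaling, takes values in `E` itself. Its eigenvectors for nonzero eigenvalues are
  -- therefore already vectors of `E`.
  have hball : ∀ x ∈ Metric.ball (0 : UniformSpace.Completion E) 1, R x ∈ ι '' K := by
    intro x hx
    have hx' := hd.open_subset_closure_inter Metric.isOpen_ball hx
    have := map_mem_closure R.continuous hx' (t := ι '' K) (by
      rintro _ ⟨hy, y, rfl⟩
      rw [hR]
      refine mem_image_of_mem _ (hKS (mem_image_of_mem _ ?_))
      simpa [hnorm] using hy)
    rwa [(hK.image ι.continuous).isClosed.closure_eq] at this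
  have hRc : IsCompactOperator R :=
    ⟨ι '' K, hK.image ι.continuous, mem_of_superset (Metric.ball_mem_nhds _ one_pos) hball⟩
  have hRs : (R : UniformSpace.Completion E →ₗ[ℝ] UniformSpace.Completion E).IsSymmetric := by
    intro x y
    refine UniformSpace.Completion.induction_on₂ x y ?_ ?_
    · exact isClosed_eq
        (UniformSpace.Completion.Continuous.inner (R.continuous.comp continuous_fst) continuous_snd)
        (UniformSpace.Completion.Continuous.inner continuous_fst (R.continuous.comp continuous_snd))
    · intro a b
      change ⟪R (ι a), ι b⟫_ℝ = ⟪ι a, R (ι b)⟫_ℝ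
      rw [hR, hR, hinner, hinner]
      exact hS a b
  have hrange : ∀ x, ∃ y, R x = ι y := by
    intro x
    have h0 : 0 < ‖x‖ + 1 := by positivity
    obtain ⟨y, -, hy⟩ := hball ((‖x‖ + 1)⁻¹ • x) (by
      rw [mem_ball_zero_iff, norm_smul, norm_inv, Real.norm_of_nonneg h0.le, inv_mul_lt_one₀ h0]
      exact lt_add_one _)
    refine ⟨(‖x‖ + 1) • y, ?_⟩
    rw [map_smul, hy, map_smul, smul_inv_smul₀ h0.ne']
  have hle : (⨆ μ, eigenspace (R : Module.End ℝ (UniformSpace.Completion E)) μ).map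
      (R : UniformSpace.Completion E →ₗ[ℝ] UniformSpace.Completion E) ≤
      F.map (ι : E →ₗ[ℝ] UniformSpace.Completion E) := by
    rw [Submodule.map_iSup]
    refine iSup_le fun μ => ?_
    rintro _ ⟨x, hx, rfl⟩
    have hx : R x = μ • x := mem_eigenspace_iff.1 hx
    change R x ∈ _
    rcases eq_or_ne μ 0 with rfl | hμ
    · rw [hx, zero_smul]
      exact zero_mem _
    · obtain ⟨y, hy⟩ := hrange x
      have hxy : x = ι (μ⁻¹ • y) := by
        rw [map_smul, ← hy, hx, inv_smul_smul₀ hμ]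
      have hSy : S (μ⁻¹ • y) = μ • μ⁻¹ • y := by
        apply hinj
        rw [← hR, ← hxy, hx, map_smul _ μ, ← hxy]
      rw [hxy, hR]
      refine Submodule.mem_map_of_mem ?_
      rw [hSy]
      exact F.smul_mem _ (Submodule.subset_span ⟨μ, hμ, hSy⟩)
  have htop : (⨆ μ, eigenspace (R : Module.End ℝ (UniformSpace.Completion E)) μ).topologicalClosure
      = ⊤ :=
    Submodule.topologicalClosure_eq_top_iff.2
      (ContinuousLinearMap.orthogonalComplement_iSup_eigenspaces_eq_bot hRc hRs)
  have hg : ι g ∈ closure ((⨆ μ, eigenspace (R : Module.End ℝ (UniformSpace.Completion E)) μ :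
      Submodule ℝ (UniformSpace.Completion E)) : Set (UniformSpace.Completion E)) := by
    rw [← Submodule.topologicalClosure_coe, htop]
    trivial
  rw [hu.isInducing.closure_eq_preimage_closure_image, mem_preimage, ← hR]
  exact map_mem_closure R.continuous hg fun x hx => hle (Submodule.mem_map_of_mem hx)

/-- If `a + b` approximates `h`, then `b` alone does so at least as well: `h - b` is orthogonal to
`a`, and dropping `a` can only shorten the error by Pythagoras. -/
theorem mem_closure_of_mem_closure_sup {A B : Submodule ℝ E} (hAB : A ⟂ B) {h : E}
    (hh : h ∈ closure ((A ⊔ B : Submodule ℝ E) : Set E)) (hA : h ∈ Aᗮ) : h ∈ closure (B : Set E) := by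
  rw [Metric.mem_closure_iff] at hh ⊢
  intro ε hε
  obtain ⟨y, hy, hyε⟩ := hh ε hε
  obtain ⟨a, ha, b, hb, rfl⟩ := Submodule.mem_sup.1 hy
  refine ⟨b, hb, lt_of_le_of_lt ?_ hyε⟩
  rw [dist_eq_norm, dist_eq_norm]
  have h0 : ⟪h - b, a⟫_ℝ = 0 := by
    rw [inner_sub_left, (Submodule.mem_orthogonal' A h).1 hA a ha,
      real_inner_comm, hAB.inner_eq ha hb, sub_zero]
  have h1 : h - (a + b) = (h - b) - a := by abel
  rw [h1]
  have := norm_sub_sq_real (h - b) a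
  rw [h0] at this
  refine le_of_sq_le_sq ?_ (norm_nonneg _)
  nlinarith [sq_nonneg ‖a‖]

theorem inner_eigenvectors_eq_zero (hS : (S : E →ₗ[ℝ] E).IsSymmetric) {κ μ : ℝ} (hne : κ ≠ μ)
    {x y : E} (hx : S x = κ • x) (hy : S y = μ • y) : ⟪x, y⟫_ℝ = 0 := by
  have h : ⟪S x, y⟫_ℝ = ⟪x, S y⟫_ℝ := hS x y
  rw [hx, hy, real_inner_smul_left, real_inner_smul_right] at h
  have : (κ - μ) * ⟪x, y⟫_ℝ = 0 := by linarith
  exact (mul_eq_zero.1 this).resolve_left (sub_ne_zero.2 hne)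

/-- Group a combination of eigenvectors by eigenvalue: the components are orthogonal, and Pythagoras
before and after applying `S` compares the norms termwise. -/
theorem norm_apply_le_of_mem_span (hS : (S : E →ₗ[ℝ] E).IsSymmetric) {c : ℝ} (hc : 0 ≤ c) {x : E}
    (hx : x ∈ Submodule.span ℝ {x | ∃ κ : ℝ, |κ| ≤ c ∧ S x = κ • x}) : ‖S x‖ ≤ c * ‖x‖ := by
  have hle : Submodule.span ℝ {x | ∃ κ : ℝ, |κ| ≤ c ∧ S x = κ • x} ≤
      ⨆ κ : {κ : ℝ // |κ| ≤ c}, eigenspace (S : Module.End ℝ E) κ.1 := by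
    refine Submodule.span_le.2 ?_
    rintro y ⟨κ, hκ, hy⟩
    exact Submodule.mem_iSup_of_mem (⟨κ, hκ⟩ : {κ : ℝ // |κ| ≤ c}) (mem_eigenspace_iff.2 hy)
  obtain ⟨f, hf, rfl⟩ := (Submodule.mem_iSup_iff_exists_finsupp _ _).1 (hle hx)
  have horth := hS.orthogonalFamily_eigenspaces.comp
    (Subtype.coe_injective : Function.Injective ((↑) : {κ : ℝ // |κ| ≤ c} → ℝ))
  have h1 := horth.norm_sum (fun κ => ⟨f κ, hf κ⟩) f.support
  have h2 := horth.norm_sum (fun κ => κ.1 • ⟨f κ, hf κ⟩) f.support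
  have hsum : S (f.sum fun _ y => y) = ∑ κ ∈ f.support, κ.1 • f κ := by
    rw [Finsupp.sum, map_sum]
    exact Finset.sum_congr rfl fun κ _ => mem_eigenspace_iff.1 (hf κ)
  refine le_of_sq_le_sq ?_ (by positivity)
  rw [hsum, mul_pow, Finsupp.sum]
  change ‖∑ κ ∈ f.support, f κ‖ ^ 2 = ∑ κ ∈ f.support, ‖f κ‖ ^ 2 at h1
  change ‖∑ κ ∈ f.support, κ.1 • f κ‖ ^ 2 = ∑ κ ∈ f.support, ‖κ.1 • f κ‖ ^ 2 at h2
  rw [h2, h1, Finset.mul_sum]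
  refine Finset.sum_le_sum fun κ _ => ?_
  rw [norm_smul, mul_pow]
  gcongr
  exact κ.2

/-- The rescaled powers contract the closed span, and on each eigenvector they decay geometrically.
Convergence on the span and the uniform bound give convergence on the closure, without any spectral
gap below `c`. -/
theorem tendsto_inv_pow_smul_pow_apply (hS : (S : E →ₗ[ℝ] E).IsSymmetric) {c : ℝ} (hc : 0 < c)
    {x : E} (hx : x ∈ closure
      (Submodule.span ℝ {x | ∃ κ : ℝ, |κ| < c ∧ S x = κ • x} : Set E)) :
    Tendsto (fun n : ℕ => c⁻¹ ^ n • (S ^ n) x) atTop (𝓝 0) := by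
  set F := Submodule.span ℝ {x | ∃ κ : ℝ, |κ| < c ∧ S x = κ • x}
  have hmap : ∀ y ∈ F, S y ∈ F := by
    intro y hy
    induction hy using Submodule.span_induction with
    | mem y hy =>
      obtain ⟨κ, hκ, h⟩ := hy
      rw [h]
      exact F.smul_mem _ (Submodule.subset_span ⟨κ, hκ, h⟩)
    | zero => simp
    | add y z _ _ hy hz => rw [map_add]; exact F.add_mem hy hz
    | smul a y _ hy => rw [map_smul]; exact F.smul_mem a hy
  have hbound : ∀ y ∈ closure (F : Set E), ‖S y‖ ≤ c * ‖y‖ := by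
    intro y hy
    refine closure_minimal (fun z hz => ?_)
      (isClosed_le S.continuous.norm (continuous_const.mul continuous_norm)) hy
    refine norm_apply_le_of_mem_span hS hc.le (Submodule.span_mono ?_ hz)
    rintro w ⟨κ, hκ, h⟩
    exact ⟨κ, hκ.le, h⟩
  have hpow : ∀ n : ℕ, ∀ y ∈ closure (F : Set E), ‖c⁻¹ ^ n • (S ^ n) y‖ ≤ ‖y‖ := by
    intro n
    induction n with
    | zero => intro y _; simp
    | succ n ih =>
      intro y hy
      have hSy : S y ∈ closure (F : Set E) := map_mem_closure S.continuous hy hmap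
      have h1 := ih _ hSy
      have h2 := hbound y hy
      have h3 : c⁻¹ ^ (n + 1) • (S ^ (n + 1)) y = c⁻¹ • c⁻¹ ^ n • (S ^ n) (S y) := by
        rw [smul_smul, ← pow_succ', pow_succ S]
        rfl
      rw [h3, norm_smul, norm_inv, Real.norm_of_nonneg hc.le, inv_mul_le_iff₀ hc]
      exact h1.trans h2
  have htend : ∀ y ∈ F, Tendsto (fun n : ℕ => c⁻¹ ^ n • (S ^ n) y) atTop (𝓝 0) := by
    intro y hy
    induction hy using Submodule.span_induction with
    | mem y hy =>
      obtain ⟨κ, hκ, h⟩ := hy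
      have hn : ∀ n : ℕ, c⁻¹ ^ n • (S ^ n) y = (c⁻¹ * κ) ^ n • y := by
        intro n
        induction n with
        | zero => simp
        | succ n ih =>
          have h3 : c⁻¹ ^ (n + 1) • (S ^ (n + 1)) y = c⁻¹ • c⁻¹ ^ n • (S ^ n) (S y) := by
            rw [smul_smul, ← pow_succ', pow_succ S]
            rfl
          rw [h3, h, map_smul, smul_comm _ κ, ih, smul_smul, smul_smul, pow_succ]
          ring_nf
      simp_rw [hn]
      have : |c⁻¹ * κ| < 1 := by
        rw [abs_mul, abs_inv, abs_of_pos hc, inv_mul_lt_one₀ hc]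
        exact hκ
      simpa using (tendsto_pow_atTop_nhds_zero_of_abs_lt_one this).smul_const y
    | zero => simp
    | add y z _ _ hy hz => simpa using hy.add hz
    | smul a y _ hy =>
      have := hy.const_smul a
      simp only [smul_zero] at this
      refine this.congr fun n => ?_
      rw [map_smul, smul_comm]
  rw [Metric.tendsto_atTop]
  intro ε hε
  obtain ⟨y, hy, hxy⟩ := Metric.mem_closure_iff.1 hx (ε / 2) (half_pos hε)
  obtain ⟨n₀, hn₀⟩ := Metric.tendsto_atTop.1 (htend y hy) (ε / 2) (half_pos hε)
  refine ⟨n₀, fun n hn => ?_⟩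
  have h1 := hn₀ n hn
  rw [dist_zero_right] at h1 ⊢
  have hmem : x - y ∈ closure (F : Set E) := by
    rw [← Submodule.topologicalClosure_coe] at hx ⊢
    exact F.topologicalClosure.sub_mem hx (F.le_topologicalClosure hy)
  have h2 := hpow n _ hmem
  rw [dist_eq_norm] at hxy
  have h3 : c⁻¹ ^ n • (S ^ n) x = c⁻¹ ^ n • (S ^ n) (x - y) + c⁻¹ ^ n • (S ^ n) y := by
    rw [map_sub, smul_sub, sub_add_cancel]
  rw [h3]
  linarith [norm_add_le (c⁻¹ ^ n • (S ^ n) (x - y)) (c⁻¹ ^ n • (S ^ n) y)]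

/-- A compact symmetric operator has only finitely many eigenvalues above a positive number. -/
theorem finite_eigenvalues_ge (hS : (S : E →ₗ[ℝ] E).IsSymmetric) (hc : IsCompactOperator S)
    {c : ℝ} (hc0 : 0 < c) : {κ : ℝ | c ≤ κ ∧ ∃ x, x ≠ 0 ∧ S x = κ • x}.Finite := by
  by_contra hinf
  let φ := Set.Infinite.natEmbedding _ hinf
  have hφ : ∀ n, ∃ x : E, ‖x‖ = 1 ∧ S x = (φ n).1 • x := by
    intro n
    obtain ⟨x, hx0, hx⟩ := (φ n).2.2
    refine ⟨‖x‖⁻¹ • x, ?_, ?_⟩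
    · rw [norm_smul, norm_inv, norm_norm, inv_mul_cancel₀ (norm_ne_zero_iff.2 hx0)]
    · rw [map_smul, hx, smul_comm]
  choose e he1 heS using hφ
  obtain ⟨K, hK, hKS⟩ := IsCompactOperator.image_closedBall_subset_compact
    (f := (S : E →ₗ[ℝ] E)) hc 1
  obtain ⟨y, -, ψ, hψ, hlim⟩ := hK.tendsto_subseq (x := fun n => S (e n)) fun n =>
    hKS (mem_image_of_mem _ (by simp [he1]))
  have hcau := hlim.cauchySeq
  rw [Metric.cauchySeq_iff'] at hcau
  obtain ⟨n₀, hn₀⟩ := hcau c hc0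
  have h1 := hn₀ (n₀ + 1) (Nat.le_succ _)
  simp only [Function.comp, dist_eq_norm] at h1
  have hne : (φ (ψ (n₀ + 1))).1 ≠ (φ (ψ n₀)).1 := fun h =>
    (hψ (Nat.lt_succ_self n₀)).ne' (φ.injective (Subtype.ext h))
  -- The images of two orthonormal eigenvectors with distinct eigenvalues at least `c` are at
  -- distance at least `c`, so no subsequence of them is Cauchy.
  have horth := inner_eigenvectors_eq_zero hS hne (heS (ψ (n₀ + 1))) (heS (ψ n₀))
  have h2 := norm_sub_sq_real (S (e (ψ (n₀ + 1)))) (S (e (ψ n₀)))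
  rw [heS, heS, real_inner_smul_left, real_inner_smul_right, horth] at h2
  rw [heS, heS] at h1
  simp only [norm_smul, he1, Real.norm_eq_abs, mul_one, sq_abs, mul_zero, sub_zero] at h2
  have h3 := (φ (ψ (n₀ + 1))).2.1
  have h4 := norm_nonneg ((φ (ψ (n₀ + 1))).1 • e (ψ (n₀ + 1)) - (φ (ψ n₀)).1 • e (ψ n₀))
  nlinarith [sq_nonneg (φ (ψ n₀)).1]

/-- On the eigenspace `S` is a nonzero multiple of the identity, which is thus compact. Finite
dimension supplies the orthogonal projection although `E` need not be complete. -/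
theorem finiteDimensional_eigenspace (hc : IsCompactOperator S) {κ : ℝ} (hκ : κ ≠ 0) :
    FiniteDimensional ℝ (eigenspace (S : Module.End ℝ E) κ) := by
  have hcl : IsClosed ((eigenspace (S : Module.End ℝ E) κ : Submodule ℝ E) : Set E) := by
    have : ((eigenspace (S : Module.End ℝ E) κ : Submodule ℝ E) : Set E) = {x | S x = κ • x} := by
      ext x
      exact mem_eigenspace_iff
    rw [this]
    exact isClosed_eq S.continuous (continuous_const_smul κ)
  have hT := IsCompactOperator.restrict (f := (S : E →ₗ[ℝ] E)) hc
    ((Module.End.mem_invtSubmodule_iff_forall_mem_of_mem _).mp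
      (eigenspace_mem_invtSubmodule (S : E →ₗ[ℝ] E) κ)) hcl
  rw [restrict_eigenspace, LinearMap.coe_smul, IsCompactOperator.smul_iff₀ hκ] at hT
  exact FiniteDimensional.of_isCompactOperator_id hT

/-- The power iteration for a compact symmetric operator, started at a vector of the closed span of
eigenvectors for positive eigenvalues, converges after rescaling to the projection of the vector to
the eigenspace of the largest eigenvalue that it sees. -/
theorem exists_dominant_eigenvector (hS : (S : E →ₗ[ℝ] E).IsSymmetric) (hc : IsCompactOperator S)
    {G : Set E} (hG : ∀ a ∈ G, ∃ κ : ℝ, 0 < κ ∧ S a = κ • a) {h : E} (h0 : h ≠ 0)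
    (hh : h ∈ closure (Submodule.span ℝ G : Set E)) :
    ∃ (κ : ℝ) (u : E), 0 < κ ∧ u ≠ 0 ∧ S u = κ • u ∧ (∃ a ∈ G, S a = κ • a) ∧
      (∀ v, S v = κ • v → ⟪h - u, v⟫_ℝ = 0) ∧
      (∀ μ v, S v = μ • v → ⟪h, v⟫_ℝ ≠ 0 → μ ≤ κ) ∧
      Tendsto (fun n : ℕ => κ⁻¹ ^ n • (S ^ n) (h - u)) atTop (𝓝 0) := by
  have hclos : ∀ v : E, (∀ a ∈ G, ⟪a, v⟫_ℝ = 0) → ⟪h, v⟫_ℝ = 0 := by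
    intro v hv
    refine closure_minimal (fun z hz => ?_)
      (isClosed_eq (f := fun z : E => ⟪z, v⟫_ℝ) (g := fun _ => 0) (by fun_prop) (by fun_prop)) hh
    change ⟪z, v⟫_ℝ = 0
    induction hz using Submodule.span_induction with
    | mem y hy => exact hv y hy
    | zero => simp
    | add y z _ _ hy hz => rw [inner_add_left, hy, hz, add_zero]
    | smul a y _ hy => rw [real_inner_smul_left, hy, mul_zero]
  let K : Set ℝ := {κ | ∃ v, S v = κ • v ∧ ⟪h, v⟫_ℝ ≠ 0}
  have hKG : ∀ κ ∈ K, ∃ a ∈ G, S a = κ • a := by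
    rintro κ ⟨v, hv, hhv⟩
    by_contra! hcon
    refine hhv (hclos v fun a ha => ?_)
    obtain ⟨μ, -, hμ⟩ := hG a ha
    refine inner_eigenvectors_eq_zero hS ?_ hμ hv
    rintro rfl
    exact hcon a ha hμ
  have hKne : K.Nonempty := by
    by_contra! hcon
    refine h0 (inner_self_eq_zero (𝕜 := ℝ).1 (hclos h fun a ha => ?_))
    obtain ⟨μ, -, hμ⟩ := hG a ha
    by_contra hne
    have : μ ∈ K := ⟨a, hμ, by rwa [real_inner_comm]⟩
    rw [hcon] at this
    exact this
  have hKpos : ∀ κ ∈ K, 0 < κ := by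
    rintro κ hκ
    obtain ⟨v, hv, hhv⟩ := id hκ
    by_contra hneg
    refine hhv (hclos v fun a ha => ?_)
    obtain ⟨μ, hμ0, hμ⟩ := hG a ha
    exact inner_eigenvectors_eq_zero hS (by rintro rfl; exact hneg hμ0) hμ hv
  obtain ⟨κ₀, hκ₀⟩ := hKne
  -- `K` may accumulate at 0, so its maximum is sought among the finitely many elements above a
  -- given one.
  have hfin : (K ∩ Ici κ₀).Finite := by
    refine (finite_eigenvalues_ge hS hc (hKpos κ₀ hκ₀)).subset ?_
    rintro κ ⟨⟨v, hv, hhv⟩, hκ⟩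
    refine ⟨hκ, v, ?_, hv⟩
    rintro rfl
    simp at hhv
  obtain ⟨κ, hκmem, hκmax⟩ := hfin.exists_maximalFor id _ ⟨κ₀, hκ₀, self_mem_Ici⟩
  have hmax : ∀ μ ∈ K, μ ≤ κ := by
    intro μ hμ
    by_contra! hlt
    exact absurd (hκmax ⟨hμ, le_trans hκmem.2 hlt.le⟩ hlt.le) (not_le.2 hlt)
  have hκ0 := hKpos κ hκmem.1
  have := finiteDimensional_eigenspace hc hκ0.ne'
  let V := eigenspace (S : Module.End ℝ E) κ
  let u : E := V.starProjection h
  have hu : S u = κ • u := mem_eigenspace_iff.1 (V.starProjection_apply_mem h)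
  have hproj : ∀ v, S v = κ • v → ⟪h - u, v⟫_ℝ = 0 := fun v hv =>
    V.starProjection_inner_eq_zero h v (mem_eigenspace_iff.2 hv)
  refine ⟨κ, u, hκ0, ?_, hu, hKG κ hκmem.1, hproj, fun μ v hv hhv => hmax μ ⟨v, hv, hhv⟩, ?_⟩
  · intro hu0
    obtain ⟨v, hv, hhv⟩ := hκmem.1
    have := hproj v hv
    rw [hu0, sub_zero] at this
    exact hhv this
  -- What remains is that `h - u` lies in the closed span of the eigenvectors below `κ`. It is
  -- orthogonal to those at `κ` by projection and to those above `κ` by maximality.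
  refine tendsto_inv_pow_smul_pow_apply hS hκ0 ?_
  refine mem_closure_of_mem_closure_sup
    (A := Submodule.span ℝ {x | ∃ μ : ℝ, κ ≤ μ ∧ S x = μ • x}) ?_ ?_ ?_
  · rw [Submodule.isOrtho_span]
    rintro x ⟨μ, hμ, hx⟩ y ⟨ν, hν, hy⟩
    refine inner_eigenvectors_eq_zero hS ?_ hx hy
    have := (abs_lt.1 hν).2
    linarith
  · have hle : Submodule.span ℝ G ≤ Submodule.span ℝ {x | ∃ μ : ℝ, κ ≤ μ ∧ S x = μ • x} ⊔
        Submodule.span ℝ {x | ∃ μ : ℝ, |μ| < κ ∧ S x = μ • x} := by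
      refine Submodule.span_le.2 fun a ha => ?_
      obtain ⟨μ, hμ0, hμ⟩ := hG a ha
      rcases le_or_gt κ μ with hle | hlt
      · exact Submodule.mem_sup_left (Submodule.subset_span ⟨μ, hle, hμ⟩)
      · exact Submodule.mem_sup_right (Submodule.subset_span ⟨μ, by rwa [abs_of_pos hμ0], hμ⟩)
    rw [← Submodule.topologicalClosure_coe] at hh ⊢
    refine Submodule.sub_mem _ (Submodule.topologicalClosure_mono hle hh) ?_
    exact Submodule.le_topologicalClosure _
      (Submodule.mem_sup_left (Submodule.subset_span ⟨κ, le_rfl, hu⟩))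
  · rw [Submodule.mem_orthogonal']
    intro x hx
    induction hx using Submodule.span_induction with
    | mem x hx =>
      obtain ⟨μ, hμ, hx⟩ := hx
      rcases hμ.eq_or_lt with rfl | hlt
      · exact hproj x hx
      · rw [inner_sub_left, inner_eigenvectors_eq_zero hS hlt.ne hu hx, sub_zero]
        by_contra hne
        exact absurd (hmax μ ⟨x, hx, hne⟩) (not_le.2 hlt)
    | zero => simp
    | add y z _ _ hy hz => rw [inner_add_right, hy, hz, add_zero]
    | smul a y _ hy => rw [real_inner_smul_right, hy, mul_zero]

end CompactSymmetric

end NormedPlane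

namespace NormedPlane

/-! ### The determinant form -/

section Plane

theorem det_smul_left (a : ℝ) (x y : ℝ × ℝ) : det (a • x) y = a * det x y := by
  simp only [det, Prod.smul_fst, Prod.smul_snd, smul_eq_mul]; ring

theorem det_smul_right (a : ℝ) (x y : ℝ × ℝ) : det x (a • y) = a * det x y := by
  simp only [det, Prod.smul_fst, Prod.smul_snd, smul_eq_mul]; ring

theorem det_sub_left (x y z : ℝ × ℝ) : det (x - y) z = det x z - det y z := by
  simp only [det, Prod.fst_sub, Prod.snd_sub]; ring

theorem det_neg_left (x y : ℝ × ℝ) : det (-x) y = -det x y := by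
  simp only [det, Prod.fst_neg, Prod.snd_neg]; ring

theorem det_neg_right (x y : ℝ × ℝ) : det x (-y) = -det x y := by
  simp only [det, Prod.fst_neg, Prod.snd_neg]; ring

theorem det_self (x : ℝ × ℝ) : det x x = 0 := by
  simp only [det]; ring

theorem det_swap (x y : ℝ × ℝ) : det x y = -det y x := by
  simp only [det]; ring

theorem eq_det_smul_sub_det_smul {x y : ℝ × ℝ} (h : det x y = 1) (z : ℝ × ℝ) :
    z = det z y • x - det z x • y := by
  simp only [det] at h
  ext
  · simp only [det, Prod.fst_sub, Prod.smul_fst, smul_eq_mul]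
    linear_combination (-z.1) * h
  · simp only [det, Prod.snd_sub, Prod.smul_snd, smul_eq_mul]
    linear_combination (-z.2) * h

theorem HasDerivAt.det {f g : ℝ → ℝ × ℝ} {f' g' : ℝ × ℝ} {t : ℝ} (hf : HasDerivAt f f' t)
    (hg : HasDerivAt g g' t) :
    HasDerivAt (fun s => NormedPlane.det (f s) (g s))
      (NormedPlane.det f' (g t) + NormedPlane.det (f t) g') t := by
  have hf1 : HasDerivAt (fun s => (f s).1) f'.1 t := (hasFDerivAt_fst.comp_hasDerivAt t hf :)
  have hf2 : HasDerivAt (fun s => (f s).2) f'.2 t := (hasFDerivAt_snd.comp_hasDerivAt t hf :)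
  have hg1 : HasDerivAt (fun s => (g s).1) g'.1 t := (hasFDerivAt_fst.comp_hasDerivAt t hg :)
  have hg2 : HasDerivAt (fun s => (g s).2) g'.2 t := (hasFDerivAt_snd.comp_hasDerivAt t hg :)
  refine ((hf1.mul hg2).sub (hf2.mul hg1)).congr_deriv ?_
  simp only [NormedPlane.det]
  ring

theorem ContDiff.det {n : WithTop ℕ∞} {f g : ℝ → ℝ × ℝ} (hf : ContDiff ℝ n f)
    (hg : ContDiff ℝ n g) : ContDiff ℝ n fun s => NormedPlane.det (f s) (g s) :=
  (hf.fst.mul hg.snd).sub (hf.snd.mul hg.fst)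

end Plane

/-- The regularity, positivity and symmetry of the weights `[p, p']` and `[q, q']` which the
Sturm-Liouville theory of `T` relies on. -/
structure RegularWeights (p : ℝ → ℝ × ℝ) : Prop where
  continuous_wt : Continuous (wt p)
  contDiff_dualWt : ContDiff ℝ 1 (dualWt p)
  wt_pos : ∀ θ, 0 < wt p θ
  dualWt_pos : ∀ θ, 0 < dualWt p θ
  wt_periodic : Function.Periodic (wt p) π
  dualWt_periodic : Function.Periodic (dualWt p) π

/-! ### Geometry of the unit circle and its dual -/

namespace IsUnitCircleParam

variable {N : Seminorm ℝ (ℝ × ℝ)} {α : ℝ} {p : ℝ → ℝ × ℝ}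

theorem contDiff_deriv (hp : IsUnitCircleParam N α p) : ContDiff ℝ (⊤ : ℕ∞) (deriv p) :=
  ((contDiff_infty_iff_deriv (𝕜 := ℝ)).1 hp.smooth).2

theorem hasDerivAt (hp : IsUnitCircleParam N α p) (θ : ℝ) : HasDerivAt p (deriv p θ) θ :=
  (hp.smooth.differentiable (by simp) θ).hasDerivAt

/-- The Euclidean support function of the unit circle is positive. -/
theorem det_dir_pos (hp : IsUnitCircleParam N α p) (θ : ℝ) :
    0 < det (p θ) (cos (θ + α), sin (θ + α)) := by
  choose ρ hρ hd using hp.tangent_angle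
  let F : ℝ → ℝ := fun t => det (p t) (cos (θ + α), sin (θ + α))
  have hF : ∀ t, HasDerivAt F (ρ t * sin (θ - t)) t := by
    intro t
    refine (HasDerivAt.det (hp.hasDerivAt t) (hasDerivAt_const t _)).congr_deriv ?_
    rw [hd, show θ - t = (θ + α) - (t + α) by ring, sin_sub]
    simp only [det, Prod.smul_fst, Prod.smul_snd, smul_eq_mul, Prod.fst_zero, Prod.snd_zero]
    ring
  -- The derivative has the sign of `sin (θ - t)`, so `F` decreases strictly over a half turn, while
  -- antiperiodicity gives it opposite values at the two ends.
  have hanti : StrictAntiOn F (Icc θ (θ + π)) := by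
    refine strictAntiOn_of_deriv_neg (convex_Icc _ _)
      (fun t _ => (hF t).continuousAt.continuousWithinAt) fun t ht => ?_
    rw [interior_Icc] at ht
    rw [(hF t).deriv]
    refine mul_neg_of_pos_of_neg (hρ t) (sin_neg_of_neg_of_neg_pi_lt ?_ ?_) <;>
      linarith [ht.1, ht.2]
  have hlt := hanti (left_mem_Icc.2 (by linarith [pi_pos])) (right_mem_Icc.2 (by linarith [pi_pos]))
    (by linarith [pi_pos] : θ < θ + π)
  have : F (θ + π) = -F θ := by simp only [F, hp.antiperiodic, det_neg_left]
  change 0 < F θ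
  linarith

theorem wt_pos (hp : IsUnitCircleParam N α p) (θ : ℝ) : 0 < wt p θ := by
  obtain ⟨ρ, hρ, hd⟩ := hp.tangent_angle θ
  rw [wt, hd, det_smul_right]
  exact mul_pos hρ (hp.det_dir_pos θ)

theorem contDiff_wt (hp : IsUnitCircleParam N α p) : ContDiff ℝ (⊤ : ℕ∞) (wt p) :=
  ContDiff.det hp.smooth hp.contDiff_deriv

theorem contDiff_dual (hp : IsUnitCircleParam N α p) : ContDiff ℝ (⊤ : ℕ∞) (dual p) :=
  (hp.contDiff_wt.inv fun θ => (hp.wt_pos θ).ne').smul hp.contDiff_deriv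

theorem contDiff_dualWt (hp : IsUnitCircleParam N α p) : ContDiff ℝ (⊤ : ℕ∞) (dualWt p) :=
  ContDiff.det hp.contDiff_dual ((contDiff_infty_iff_deriv (𝕜 := ℝ)).1 hp.contDiff_dual).2

theorem deriv_eq (hp : IsUnitCircleParam N α p) (θ : ℝ) : deriv p θ = wt p θ • dual p θ := by
  rw [dual, smul_inv_smul₀ (hp.wt_pos θ).ne']

theorem det_dual (hp : IsUnitCircleParam N α p) (θ : ℝ) : det (p θ) (dual p θ) = 1 := by
  rw [dual, det_smul_right]
  exact inv_mul_cancel₀ (hp.wt_pos θ).ne'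

/-- Differentiating `[p, q] = 1` gives `[p, q'] = 0`, because `p'` is parallel to `q`. So `q'` is a
multiple of `p`, and pairing with `q` identifies the factor. -/
theorem hasDerivAt_dual (hp : IsUnitCircleParam N α p) (θ : ℝ) :
    HasDerivAt (dual p) (-dualWt p θ • p θ) θ := by
  have hq := (hp.contDiff_dual.differentiable (by simp) θ).hasDerivAt
  refine hq.congr_deriv ?_
  have h1 := HasDerivAt.det (hp.hasDerivAt θ) hq
  simp_rw [hp.det_dual] at h1
  have h2 := h1.unique (hasDerivAt_const θ 1)
  rw [hp.deriv_eq, det_smul_left, det_self, mul_zero, zero_add] at h2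
  rw [eq_det_smul_sub_det_smul (hp.det_dual θ) (deriv (dual p) θ), det_swap _ (p θ), h2,
    det_swap, dualWt]
  simp

theorem deriv_dual (hp : IsUnitCircleParam N α p) (θ : ℝ) :
    deriv (dual p) θ = -dualWt p θ • p θ := (hp.hasDerivAt_dual θ).deriv

theorem dual_eq (hp : IsUnitCircleParam N α p) (θ : ℝ) :
    dual p θ = (det (p θ) (cos (θ + α), sin (θ + α)))⁻¹ • (cos (θ + α), sin (θ + α)) := by
  obtain ⟨ρ, hρ, hd⟩ := hp.tangent_angle θ
  rw [dual, wt, hd, det_smul_right, smul_smul, mul_inv, mul_right_comm, inv_mul_cancel₀ hρ.ne',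
    one_mul]

/-- With `e` the unit tangent direction and `c = [p, e]`, one has `q = e / c`. The derivative of `1
/ c` drops out of the determinant, so `[q, q'] = [e, e'] / c ^ 2 = 1 / c ^ 2`. -/
theorem dualWt_pos (hp : IsUnitCircleParam N α p) (θ : ℝ) : 0 < dualWt p θ := by
  have hθ : HasDerivAt (fun t => t + α) 1 θ := (hasDerivAt_id θ).add_const α
  have he : HasDerivAt (fun t => (cos (t + α), sin (t + α))) (-sin (θ + α), cos (θ + α)) θ := by
    have h1 := hθ.cos.prodMk hθ.sin
    simpa using h1
  have hc := (HasDerivAt.det (hp.hasDerivAt θ) he).inv (hp.det_dir_pos θ).ne'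
  have hq := hc.smul he
  have hq' := hq.congr_of_eventuallyEq (f₁ := dual p) (Eventually.of_forall fun t => hp.dual_eq t)
  have hpos := hp.det_dir_pos θ
  set c := det (p θ) (cos (θ + α), sin (θ + α)) with hcdef
  have key : dualWt p θ = c⁻¹ * c⁻¹ := by
    have hcθ : (fun s => det (p s) (cos (s + α), sin (s + α)))⁻¹ θ = c⁻¹ := rfl
    rw [dualWt, hq'.deriv, hp.dual_eq θ, hcθ, ← hcdef, det_smul_left]
    simp only [det, Prod.smul_fst, Prod.smul_snd, smul_eq_mul, Prod.fst_add, Prod.snd_add]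
    linear_combination (c⁻¹ * c⁻¹) * sin_sq_add_cos_sq (θ + α)
  rw [key]
  positivity

theorem deriv_antiperiodic (hp : IsUnitCircleParam N α p) : Function.Antiperiodic (deriv p) π := by
  intro θ
  have h : (fun t => p (t + π)) = fun t => -p t := funext hp.antiperiodic
  rw [← deriv_comp_add_const, h, deriv.fun_neg]

theorem wt_periodic (hp : IsUnitCircleParam N α p) : Function.Periodic (wt p) π := by
  intro θ
  rw [wt, hp.antiperiodic, hp.deriv_antiperiodic, det_neg_left, det_neg_right, neg_neg, wt]

theorem dual_antiperiodic (hp : IsUnitCircleParam N α p) : Function.Antiperiodic (dual p) π := by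
  intro θ
  rw [dual, hp.wt_periodic, hp.deriv_antiperiodic, smul_neg, dual]

theorem dualWt_periodic (hp : IsUnitCircleParam N α p) : Function.Periodic (dualWt p) π := by
  intro θ
  have h : (fun t => dual p (t + π)) = fun t => -dual p t := funext hp.dual_antiperiodic
  rw [dualWt, ← deriv_comp_add_const, h, deriv.fun_neg, hp.dual_antiperiodic, det_neg_left,
    det_neg_right, neg_neg, dualWt]

theorem regularWeights (hp : IsUnitCircleParam N α p) : RegularWeights p where
  continuous_wt := hp.contDiff_wt.continuous
  contDiff_dualWt := hp.contDiff_dualWt.of_le (by exact_mod_cast le_top)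
  wt_pos := hp.wt_pos
  dualWt_pos := hp.dualWt_pos
  wt_periodic := hp.wt_periodic
  dualWt_periodic := hp.dualWt_periodic

/-- This locates the zeros and signs of the support function of the point `q θ`: they are those of a
sine. -/
theorem det_dual_dual (hp : IsUnitCircleParam N α p) (θ τ : ℝ) :
    ∃ c > 0, det (dual p θ) (dual p τ) = c * sin (τ - θ) := by
  refine ⟨(det (p θ) (cos (θ + α), sin (θ + α)))⁻¹ * (det (p τ) (cos (τ + α), sin (τ + α)))⁻¹,
    mul_pos (inv_pos.2 (hp.det_dir_pos θ)) (inv_pos.2 (hp.det_dir_pos τ)), ?_⟩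
  rw [hp.dual_eq θ, hp.dual_eq τ, det_smul_left, det_smul_right,
    show τ - θ = (τ + α) - (θ + α) by ring, sin_sub]
  simp only [det]
  ring

end IsUnitCircleParam
end NormedPlane

/-! ### Solutions of `T g = h` and Sturm comparison -/

namespace NormedPlane

section RealFunctions

theorem forall_pos_or_forall_neg {f : ℝ → ℝ} {s : Set ℝ} (hs : IsPreconnected s)
    (hf : ContinuousOn f s) (h0 : ∀ x ∈ s, f x ≠ 0) :
    (∀ x ∈ s, 0 < f x) ∨ ∀ x ∈ s, f x < 0 := by
  by_contra! hcon
  obtain ⟨⟨x, hx, hfx⟩, y, hy, hfy⟩ := hcon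
  obtain ⟨z, hz, hfz⟩ := hs.intermediate_value hx hy hf ⟨hfx, hfy⟩
  exact h0 z hz hfz

theorem deriv_nonneg_of_nonneg_right {f : ℝ → ℝ} {d a b : ℝ} (hab : a < b) (hf : HasDerivAt f d a)
    (h0 : f a = 0) (hpos : ∀ x ∈ Ioo a b, 0 ≤ f x) : 0 ≤ d := by
  refine ge_of_tendsto (hasDerivAt_iff_tendsto_slope_left_right.1 hf).2 ?_
  filter_upwards [Ioo_mem_nhdsGT hab] with x hx
  rw [slope_def_field, h0, sub_zero]
  exact div_nonneg (hpos x hx) (sub_nonneg.2 hx.1.le)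

theorem deriv_nonpos_of_nonneg_left {f : ℝ → ℝ} {d a b : ℝ} (hab : a < b) (hf : HasDerivAt f d b)
    (h0 : f b = 0) (hpos : ∀ x ∈ Ioo a b, 0 ≤ f x) : d ≤ 0 := by
  refine le_of_tendsto (hasDerivAt_iff_tendsto_slope_left_right.1 hf).1 ?_
  filter_upwards [Ioo_mem_nhdsLT hab] with x hx
  rw [slope_def_field, h0, sub_zero]
  exact div_nonpos_of_nonneg_of_nonpos (hpos x hx) (sub_nonpos.2 hx.2.le)

theorem exists_forall_abs_le_of_periodic {f : ℝ → ℝ} {c : ℝ} (hf : Continuous f) (hc : c ≠ 0)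
    (hp : Function.Periodic f c) : ∃ C, 0 ≤ C ∧ ∀ x, |f x| ≤ C := by
  obtain ⟨C, hC⟩ := (hp.isBounded_of_continuous hc hf).exists_norm_le
  have := hC _ (mem_range_self 0)
  exact ⟨C, (norm_nonneg _).trans this, fun x => hC _ (mem_range_self x)⟩

end RealFunctions

/-- `g` is a `2π`-periodic solution of `T g = h`, with flux `m = g' / [q, q']`. -/
structure IsSolution (p : ℝ → ℝ × ℝ) (h g m : ℝ → ℝ) : Prop where
  periodic : Function.Periodic g (2 * π)
  hasDerivAt : ∀ θ, HasDerivAt g (dualWt p θ * m θ) θ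
  hasDerivAt_flux : ∀ θ, HasDerivAt m (-(wt p θ * h θ)) θ

/-- The number of zeros in a period. -/
def zeroCount (u : ℝ → ℝ) : ℕ∞ := {θ | θ ∈ Ico 0 (2 * π) ∧ u θ = 0}.encard

variable {p : ℝ → ℝ × ℝ} {h h₁ h₂ g g₁ g₂ m m₁ m₂ u v n : ℝ → ℝ} {lam mu : ℝ}

namespace IsSolution

theorem continuous (hg : IsSolution p h g m) : Continuous g :=
  continuous_iff_continuousAt.2 fun θ => (hg.hasDerivAt θ).continuousAt

theorem continuous_flux (hg : IsSolution p h g m) : Continuous m :=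
  continuous_iff_continuousAt.2 fun θ => (hg.hasDerivAt_flux θ).continuousAt

theorem add (H₁ : IsSolution p h₁ g₁ m₁) (H₂ : IsSolution p h₂ g₂ m₂) :
    IsSolution p (h₁ + h₂) (g₁ + g₂) (m₁ + m₂) where
  periodic := H₁.periodic.add H₂.periodic
  hasDerivAt θ := ((H₁.hasDerivAt θ).add (H₂.hasDerivAt θ)).congr_deriv (by
    simp only [Pi.add_apply]; ring)
  hasDerivAt_flux θ := ((H₁.hasDerivAt_flux θ).add (H₂.hasDerivAt_flux θ)).congr_deriv (by
    simp only [Pi.add_apply]; ring)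

theorem smul (c : ℝ) (H : IsSolution p h g m) : IsSolution p (c • h) (c • g) (c • m) where
  periodic := H.periodic.smul c
  hasDerivAt θ := ((H.hasDerivAt θ).const_smul c).congr_deriv (by
    simp only [Pi.smul_apply, smul_eq_mul]; ring)
  hasDerivAt_flux θ := ((H.hasDerivAt_flux θ).const_smul c).congr_deriv (by
    simp only [Pi.smul_apply, smul_eq_mul]; ring)

theorem sub (H₁ : IsSolution p h₁ g₁ m₁) (H₂ : IsSolution p h₂ g₂ m₂) :
    IsSolution p (h₁ - h₂) (g₁ - g₂) (m₁ - m₂) := by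
  simpa [sub_eq_add_neg] using H₁.add (H₂.smul (-1))

theorem add_const (H : IsSolution p h g m) (c : ℝ) :
    IsSolution p h (fun θ => g θ + c) m where
  periodic θ := by simp only [H.periodic θ]
  hasDerivAt θ := (H.hasDerivAt θ).add_const c
  hasDerivAt_flux := H.hasDerivAt_flux

theorem comp_add_pi (hW : RegularWeights p) (H : IsSolution p h g m) :
    IsSolution p (fun θ => h (θ + π)) (fun θ => g (θ + π)) (fun θ => m (θ + π)) where
  periodic θ := by
    have := H.periodic (θ + π)
    rwa [show θ + π + 2 * π = θ + 2 * π + π by ring] at this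
  hasDerivAt θ := by
    have := (H.hasDerivAt (θ + π)).comp_add_const θ π
    rwa [hW.dualWt_periodic] at this
  hasDerivAt_flux θ := by
    have := (H.hasDerivAt_flux (θ + π)).comp_add_const θ π
    rwa [hW.wt_periodic] at this

theorem deriv_eq (H : IsSolution p h g m) (θ : ℝ) : deriv g θ = dualWt p θ * m θ :=
  (H.hasDerivAt θ).deriv

theorem flux_eq (hW : RegularWeights p) (H : IsSolution p h g m) (θ : ℝ) :
    m θ = deriv g θ / dualWt p θ := by
  rw [H.deriv_eq, mul_div_cancel_left₀ _ (hW.dualWt_pos θ).ne']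

theorem flux_periodic (hW : RegularWeights p) (H : IsSolution p h g m) :
    Function.Periodic m (2 * π) := by
  intro θ
  have hz : Function.Periodic (dualWt p) (2 * π) := by
    have := hW.dualWt_periodic.nat_mul 2
    exact_mod_cast this
  have hd : deriv g (θ + 2 * π) = deriv g θ := by
    rw [← deriv_comp_add_const]
    congr 1
    exact funext H.periodic
  rw [H.flux_eq hW, H.flux_eq hW, hz, hd]

theorem T_eq (hW : RegularWeights p) (H : IsSolution p h g m) : T p g = h := by
  have hm : (fun t => deriv g t / dualWt p t) = m := funext fun t => (H.flux_eq hW t).symm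
  funext θ
  rw [T, hm, (H.hasDerivAt_flux θ).deriv]
  have := (hW.wt_pos θ).ne'
  field_simp

theorem contDiff (hW : RegularWeights p) (H : IsSolution p h g m) (hh : Continuous h) :
    ContDiff ℝ 2 g := by
  have hm : ContDiff ℝ 1 m := by
    rw [contDiff_one_iff_deriv]
    refine ⟨fun θ => (H.hasDerivAt_flux θ).differentiableAt, ?_⟩
    have : deriv m = fun θ => -(wt p θ * h θ) := funext fun θ => (H.hasDerivAt_flux θ).deriv
    rw [this]
    exact (hW.continuous_wt.mul hh).neg
  rw [show (2 : WithTop ℕ∞) = 1 + 1 by norm_num, contDiff_succ_iff_deriv]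
  refine ⟨fun θ => (H.hasDerivAt θ).differentiableAt, by simp, ?_⟩
  have : deriv g = fun θ => dualWt p θ * m θ := funext H.deriv_eq
  rw [this]
  exact hW.contDiff_dualWt.mul hm

theorem of_contDiff (hW : RegularWeights p) (hg : ContDiff ℝ 2 g)
    (hper : Function.Periodic g (2 * π)) :
    IsSolution p (T p g) g (fun θ => deriv g θ / dualWt p θ) where
  periodic := hper
  hasDerivAt θ := by
    rw [mul_div_cancel₀ _ (hW.dualWt_pos θ).ne']
    exact (hg.differentiable (by norm_num) θ).hasDerivAt
  hasDerivAt_flux θ := by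
    have hd : ContDiff ℝ 1 (deriv g) := by
      rw [show (2 : WithTop ℕ∞) = 1 + 1 by norm_num, contDiff_succ_iff_deriv] at hg
      exact hg.2.2
    have hm : ContDiff ℝ 1 fun θ => deriv g θ / dualWt p θ :=
      hd.div hW.contDiff_dualWt fun θ => (hW.dualWt_pos θ).ne'
    refine (hm.differentiable (by norm_num) θ).hasDerivAt.congr_deriv ?_
    have := (hW.wt_pos θ).ne'
    rw [T]
    field_simp

theorem hasDerivAt_wronskian (H₁ : IsSolution p h₁ g₁ m₁) (H₂ : IsSolution p h₂ g₂ m₂) (θ : ℝ) :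
    HasDerivAt (fun t => m₁ t * g₂ t - g₁ t * m₂ t)
      (wt p θ * (g₁ θ * h₂ θ - h₁ θ * g₂ θ)) θ := by
  refine (((H₁.hasDerivAt_flux θ).mul (H₂.hasDerivAt θ)).sub
    ((H₁.hasDerivAt θ).mul (H₂.hasDerivAt_flux θ))).congr_deriv ?_
  ring

/-- Zeros of nontrivial eigenfunctions are simple. -/
theorem flux_ne_zero (hW : RegularWeights p) (H : IsSolution p (lam • u) u m) (h0 : u ≠ 0)
    {a : ℝ} (ha : u a = 0) : m a ≠ 0 := by
  intro hma
  obtain ⟨C₁, hC₁, hw⟩ := exists_forall_abs_le_of_periodic hW.continuous_wt pi_ne_zero hW.wt_periodic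
  obtain ⟨C₂, hC₂, hz⟩ := exists_forall_abs_le_of_periodic hW.contDiff_dualWt.continuous pi_ne_zero
    hW.dualWt_periodic
  -- The pair of function and flux solves a linear system with bounded coefficients. If both vanish
  -- at one point, uniqueness makes them vanish everywhere.
  let V : ℝ → ℝ × ℝ → ℝ × ℝ := fun t y => (dualWt p t * y.2, -(wt p t * (lam * y.1)))
  let K : NNReal := ⟨max C₂ (C₁ * |lam|), le_max_of_le_left hC₂⟩
  have hV : ∀ t, LipschitzOnWith K (V t) univ := by
    intro t
    refine (LipschitzWith.of_dist_le_mul fun x y => ?_).lipschitzOnWith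
    rw [Prod.dist_eq]
    have hx : dist x.1 y.1 ≤ dist x y := by rw [Prod.dist_eq]; exact le_max_left _ _
    have hy : dist x.2 y.2 ≤ dist x y := by rw [Prod.dist_eq]; exact le_max_right _ _
    change max (dist (dualWt p t * x.2) (dualWt p t * y.2))
      (dist (-(wt p t * (lam * x.1))) (-(wt p t * (lam * y.1)))) ≤ max C₂ (C₁ * |lam|) * dist x y
    rw [Real.dist_eq] at hx hy ⊢
    rw [Real.dist_eq]
    refine max_le ?_ ?_
    · rw [← mul_sub, abs_mul]
      exact mul_le_mul ((hz t).trans (le_max_left _ _)) hy (abs_nonneg _)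
        (le_max_of_le_left hC₂)
    · rw [show -(wt p t * (lam * x.1)) - -(wt p t * (lam * y.1)) =
        -(wt p t * lam * (x.1 - y.1)) by ring, abs_neg, abs_mul, abs_mul]
      exact mul_le_mul ((mul_le_mul_of_nonneg_right (hw t) (abs_nonneg _)).trans (le_max_right _ _))
        hx (abs_nonneg _) (le_max_of_le_left hC₂)
  have := ODE_solution_unique_univ (v := V) (s := fun _ => univ) (f := fun t => (u t, m t))
    (g := fun _ => (0, 0)) (t₀ := a) hV
    (fun t => ⟨(H.hasDerivAt t).prodMk (H.hasDerivAt_flux t), trivial⟩)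
    (fun t => ⟨(hasDerivAt_const t _).congr_deriv (by simp [V, Prod.ext_iff]), trivial⟩) (by rw [ha, hma])
  exact h0 (funext fun t => congrArg Prod.fst (congrFun this t))

/-- Zeros are simple, hence isolated, so there is a gap to the right of `a`. Periodicity provides
the zero `a + 2 * π`, and compactness a first one after the gap. -/
theorem exists_next_zero (hW : RegularWeights p) (H : IsSolution p (lam • u) u m) (h0 : u ≠ 0)
    {a : ℝ} (ha : u a = 0) : ∃ b, a < b ∧ u b = 0 ∧ ∀ x ∈ Ioo a b, u x ≠ 0 := by
  have hd : dualWt p a * m a ≠ 0 := mul_ne_zero (hW.dualWt_pos a).ne' (H.flux_ne_zero hW h0 ha)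
  have hev : ∀ᶠ x in 𝓝[>] a, u x ≠ 0 :=
    nhdsWithin_mono a (fun x (hx : a < x) => hx.ne') ((H.hasDerivAt a).eventually_ne hd)
  obtain ⟨c, hac, hc⟩ := mem_nhdsGT_iff_exists_Ioo_subset.1 hev
  have hac : a < c := hac
  have hπ := pi_pos
  have hper : u (a + 2 * π) = 0 := by rw [H.periodic, ha]
  have hcle : c ≤ a + 2 * π := by
    by_contra! hlt
    exact hc ⟨by linarith, hlt⟩ hper
  have hcomp : IsCompact ({x | u x = 0} ∩ Icc c (a + 2 * π)) :=
    isCompact_Icc.inter_left (isClosed_eq H.continuous continuous_const)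
  obtain ⟨b, ⟨hb0, hb⟩, hmin⟩ := hcomp.exists_isLeast ⟨a + 2 * π, hper, hcle, le_rfl⟩
  refine ⟨b, hac.trans_le hb.1, hb0, fun x hx hx0 => ?_⟩
  rcases lt_or_ge x c with hxc | hcx
  · exact hc ⟨hx.1, hxc⟩ hx0
  · exact absurd (hmin ⟨hx0, hcx, hx.2.le.trans hb.2⟩) (not_le.2 hx.2)

/-- If `v` were positive, the Wronskian `m v - u n` would be nondecreasing on `[a, b]` since `lam ≤
mu`. But it is `m a * v a > 0` at `a` and `m b * v b ≤ 0` at `b`. Only `v b ≥ 0` is needed at the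
right end, so the interval can be half-open and the zeros found on consecutive intervals are
distinct. -/
theorem not_pos_on_Ico (hW : RegularWeights p) (Hu : IsSolution p (lam • u) u m)
    (Hv : IsSolution p (mu • v) v n) (hle : lam ≤ mu) (hu : u ≠ 0) {a b : ℝ} (hab : a < b)
    (ha : u a = 0) (hb : u b = 0) (hpos : ∀ x ∈ Ioo a b, 0 < u x) :
    ¬ ∀ x ∈ Ico a b, 0 < v x := by
  intro hv
  have hma : 0 < m a := by
    have h1 := deriv_nonneg_of_nonneg_right hab (Hu.hasDerivAt a) ha fun x hx => (hpos x hx).le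
    have h2 := nonneg_of_mul_nonneg_right h1 (hW.dualWt_pos a)
    exact lt_of_le_of_ne h2 (Hu.flux_ne_zero hW hu ha).symm
  have hmb : m b ≤ 0 := by
    have h1 := deriv_nonpos_of_nonneg_left hab (Hu.hasDerivAt b) hb fun x hx => (hpos x hx).le
    exact nonpos_of_mul_nonpos_right h1 (hW.dualWt_pos b)
  have hvb : 0 ≤ v b := by
    have : b ∈ closure (Ico a b) := by
      rw [closure_Ico hab.ne]
      exact right_mem_Icc.2 hab.le
    exact closure_minimal (fun x hx => (hv x hx).le) (isClosed_le continuous_const Hv.continuous) this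
  have hmono : MonotoneOn (fun t => m t * v t - u t * n t) (Icc a b) := by
    refine monotoneOn_of_deriv_nonneg (convex_Icc _ _)
      (fun t _ => (hasDerivAt_wronskian Hu Hv t).continuousAt.continuousWithinAt)
      (fun t _ => (hasDerivAt_wronskian Hu Hv t).differentiableAt.differentiableWithinAt)
      fun t ht => ?_
    rw [interior_Icc] at ht
    rw [(hasDerivAt_wronskian Hu Hv t).deriv]
    simp only [Pi.smul_apply, smul_eq_mul]
    have h1 := hpos t ht
    have h2 := hv t (Ioo_subset_Ico_self ht)
    have h3 : u t * (mu * v t) - lam * u t * v t = (mu - lam) * (u t * v t) := by ring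
    rw [h3]
    exact mul_nonneg (hW.wt_pos t).le (mul_nonneg (sub_nonneg.2 hle) (mul_pos h1 h2).le)
  have h1 := hmono (left_mem_Icc.2 hab.le) (right_mem_Icc.2 hab.le) hab.le
  simp only [ha, hb, zero_mul, sub_zero] at h1
  have h2 := mul_pos hma (hv a (left_mem_Ico.2 hab))
  have h3 := mul_nonpos_of_nonpos_of_nonneg hmb hvb
  linarith

theorem neg (H : IsSolution p (lam • u) u m) : IsSolution p (lam • -u) (-u) (-m) := by
  have := H.smul (-1)
  rwa [smul_comm, neg_one_smul, neg_one_smul] at this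

/-- **Sturm comparison.** -/
theorem exists_zero_mem_Ico (hW : RegularWeights p) (Hu : IsSolution p (lam • u) u m)
    (Hv : IsSolution p (mu • v) v n) (hle : lam ≤ mu) (hu : u ≠ 0) {a b : ℝ} (hab : a < b)
    (ha : u a = 0) (hb : u b = 0) (hne : ∀ x ∈ Ioo a b, u x ≠ 0) : ∃ c ∈ Ico a b, v c = 0 := by
  by_contra! hv
  have hu' : -u ≠ 0 := neg_ne_zero.2 hu
  rcases forall_pos_or_forall_neg isPreconnected_Ioo Hu.continuous.continuousOn hne with h1 | h1 <;>
    rcases forall_pos_or_forall_neg isPreconnected_Ico Hv.continuous.continuousOn hv with h2 | h2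
  · exact not_pos_on_Ico hW Hu Hv hle hu hab ha hb h1 h2
  · exact not_pos_on_Ico hW Hu Hv.neg hle hu hab ha hb h1 fun x hx => neg_pos.2 (h2 x hx)
  · exact not_pos_on_Ico hW Hu.neg Hv hle hu' hab (by simp [ha]) (by simp [hb])
      (fun x hx => neg_pos.2 (h1 x hx)) h2
  · exact not_pos_on_Ico hW Hu.neg Hv.neg hle hu' hab (by simp [ha]) (by simp [hb])
      (fun x hx => neg_pos.2 (h1 x hx)) fun x hx => neg_pos.2 (h2 x hx)

/-- Send each zero `a` of `u` to a zero of `v` between `a` (included) and the next zero of `u`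
(excluded). Reduction to a period keeps this map injective. -/
theorem zeroCount_le (hW : RegularWeights p) (Hu : IsSolution p (lam • u) u m)
    (Hv : IsSolution p (mu • v) v n) (hle : lam ≤ mu) (hu : u ≠ 0) :
    zeroCount u ≤ zeroCount v := by
  have hπ := two_pi_pos
  have hex : ∀ a, u a = 0 → ∃ c, v c = 0 ∧ a ≤ c ∧ ∀ d, a < d → u d = 0 → c < d := by
    intro a ha
    obtain ⟨b, hab, hb, hne⟩ := Hu.exists_next_zero hW hu ha
    obtain ⟨c, hc, hvc⟩ := exists_zero_mem_Ico hW Hu Hv hle hu hab ha hb hne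
    refine ⟨c, hvc, hc.1, fun d had hd => hc.2.trans_le ?_⟩
    by_contra! hdb
    exact hne d ⟨had, hdb⟩ hd
  choose! φ hφ0 hφle hφlt using hex
  -- For `a < b` in one period, `φ a < φ b < φ a + 2 * π`: the second inequality holds because `a +
  -- 2 * π` is a zero of `u` beyond `b`. So the two values are not congruent modulo `2 * π`.
  have key : ∀ a b, a ∈ Ico 0 (2 * π) → u a = 0 → b ∈ Ico 0 (2 * π) → u b = 0 → a < b →
      toIcoMod hπ 0 (φ a) ≠ toIcoMod hπ 0 (φ b) := by
    intro a b ha hua hb hub hab heq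
    have h1 : φ a < φ b := (hφlt a hua b hab hub).trans_le (hφle b hub)
    have h2 : φ b < φ a + 2 * π := by
      have h3 : φ b < a + 2 * π := hφlt b hub _ (by linarith [hb.2, ha.1]) (by rw [Hu.periodic, hua])
      linarith [hφle a hua]
    have h4 := toIcoMod_add_toIcoDiv_mul hπ 0 (φ a)
    have h5 := toIcoMod_add_toIcoDiv_mul hπ 0 (φ b)
    rw [heq] at h4
    have h6 : φ b - φ a = ((toIcoDiv hπ 0 (φ b) - toIcoDiv hπ 0 (φ a) : ℤ) : ℝ) * (2 * π) := by
      push_cast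
      linarith
    set k := toIcoDiv hπ 0 (φ b) - toIcoDiv hπ 0 (φ a)
    have h7 : (0 : ℝ) < k := by
      by_contra! hk
      nlinarith
    have h8 : (k : ℝ) < 1 := by
      by_contra! hk
      nlinarith
    have h9 : 0 < k := by exact_mod_cast h7
    have h10 : k < 1 := by exact_mod_cast h8
    omega
  refine encard_le_encard_of_injOn (f := fun a => toIcoMod hπ 0 (φ a)) ?_ ?_
  · rintro a ⟨-, hua⟩
    refine ⟨toIcoMod_mem_Ico' hπ _, ?_⟩
    have := Hv.periodic.sub_zsmul_eq (x := φ a) (toIcoDiv hπ 0 (φ a))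
    rw [self_sub_toIcoDiv_zsmul] at this
    rw [this, hφ0 a hua]
  · rintro a ⟨ha, hua⟩ b ⟨hb, hub⟩ heq
    rcases lt_trichotomy a b with hlt | rfl | hlt
    · exact absurd heq (key a b ha hua hb hub hlt)
    · rfl
    · exact absurd heq.symm (key b a hb hub ha hua hlt)

/-- An accumulation point of zeros would be a zero with nonzero derivative, but such a zero is
isolated. -/
theorem finite_zeros (hW : RegularWeights p) (H : IsSolution p (lam • u) u m) (h0 : u ≠ 0)
    (a b : ℝ) : {θ | θ ∈ Icc a b ∧ u θ = 0}.Finite := by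
  by_contra hinf
  obtain ⟨x, -, hx⟩ := Set.Infinite.exists_accPt_of_subset_isCompact hinf
    (isCompact_Icc (a := a) (b := b)) fun θ hθ => hθ.1
  rw [accPt_iff_frequently_nhdsNE] at hx
  have hux : u x = 0 := by
    have : x ∈ closure {θ | u θ = 0} :=
      mem_closure_iff_frequently.2 ((hx.mono fun y hy => hy.2).filter_mono nhdsWithin_le_nhds)
    rwa [(isClosed_eq H.continuous continuous_const).closure_eq] at this
  have hd : dualWt p x * m x ≠ 0 := mul_ne_zero (hW.dualWt_pos x).ne' (H.flux_ne_zero hW h0 hux)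
  exact hx (((H.hasDerivAt x).eventually_ne hd).mono fun y hy hy' => hy hy'.2)

end IsSolution

theorem zeroCount_eq_two_mul (hu : ∀ θ, u (θ + π) = 0 ↔ u θ = 0) :
    zeroCount u = 2 * {θ | θ ∈ Ico 0 π ∧ u θ = 0}.encard := by
  have hπ := pi_pos
  have hunion : {θ | θ ∈ Ico 0 (2 * π) ∧ u θ = 0} =
      {θ | θ ∈ Ico 0 π ∧ u θ = 0} ∪ (fun θ => θ + π) '' {θ | θ ∈ Ico 0 π ∧ u θ = 0} := by
    ext θ
    constructor
    · rintro ⟨hθ, h0⟩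
      rcases lt_or_ge θ π with hlt | hge
      · exact Or.inl ⟨⟨hθ.1, hlt⟩, h0⟩
      · refine Or.inr ⟨θ - π, ⟨⟨by linarith, by linarith [hθ.2]⟩, ?_⟩, by simp⟩
        rw [← hu, sub_add_cancel]
        exact h0
    · rintro (⟨hθ, h0⟩ | ⟨θ, ⟨hθ, h0⟩, rfl⟩)
      · exact ⟨⟨hθ.1, by linarith [hθ.2]⟩, h0⟩
      · exact ⟨⟨by linarith [hθ.1], by linarith [hθ.2]⟩, (hu θ).2 h0⟩
  rw [zeroCount, hunion, encard_union_eq, (add_left_injective π).injOn.encard_image, two_mul]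
  rw [Set.disjoint_left]
  rintro _ ⟨hθ, -⟩ ⟨τ, ⟨hτ, -⟩, rfl⟩
  linarith [hθ.2, hτ.1]

end NormedPlane

/-! ### The index of an eigenfunction -/

namespace NormedPlane

variable {p : ℝ → ℝ × ℝ} {h h₁ h₂ g g₁ g₂ m m₁ m₂ u v n : ℝ → ℝ} {lam mu : ℝ}

theorem IsMode.isSolution (hW : RegularWeights p) {k : ℕ} (hu : IsMode p k lam u) :
    IsSolution p (lam • u) u (fun θ => deriv u θ / dualWt p θ) := by
  rw [← hu.eigen]
  exact IsSolution.of_contDiff hW hu.contDiff hu.periodic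

namespace IsSolution

theorem isMode (hW : RegularWeights p) (H : IsSolution p (lam • u) u m) (h0 : u ≠ 0) {k : ℕ}
    (hk : zeroCount u = 2 * k) : IsMode p k lam u where
  contDiff := H.contDiff hW (H.continuous.const_smul lam)
  periodic := H.periodic
  ne_zero := h0
  eigen := H.T_eq hW
  index := hk

/-- An eigenspace contains a function which is symmetric or antisymmetric under the half turn. -/
theorem exists_symmetric (hW : RegularWeights p) (H : IsSolution p (lam • u) u m) (h0 : u ≠ 0) :
    ∃ (f l : ℝ → ℝ) (σ : ℝ), σ * σ = 1 ∧ IsSolution p (lam • f) f l ∧ f ≠ 0 ∧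
      ∀ θ, f (θ + π) = σ * f θ := by
  have hper : ∀ θ, u (θ + π + π) = u θ := fun θ => by
    rw [show θ + π + π = θ + 2 * π by ring, H.periodic]
  -- The weights have period `π`, so translates by `π` stay in the eigenspace. The even part (`σ =
  -- 1`) and the odd part (`σ = -1`) under the half turn cannot both vanish.
  have key : ∀ σ : ℝ, σ * σ = 1 → (fun θ => u θ + σ * u (θ + π)) ≠ 0 →
      ∃ (f l : ℝ → ℝ) (σ : ℝ), σ * σ = 1 ∧ IsSolution p (lam • f) f l ∧ f ≠ 0 ∧
        ∀ θ, f (θ + π) = σ * f θ := by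
    intro σ hσ hne
    refine ⟨fun θ => u θ + σ * u (θ + π), fun θ => m θ + σ * m (θ + π), σ, hσ, ?_, hne, ?_⟩
    · have := H.add ((H.comp_add_pi hW).smul σ)
      convert! this using 1
      funext θ
      simp only [Pi.smul_apply, Pi.add_apply, smul_eq_mul]
      ring
    · intro θ
      simp only [hper]
      linear_combination (-u (θ + π)) * hσ
  by_cases h1 : (fun θ => u θ + 1 * u (θ + π)) = 0
  · refine key (-1) (by norm_num) fun h2 => h0 (funext fun θ => ?_)
    have h3 := congrFun h1 θ
    have h4 := congrFun h2 θ
    simp only [Pi.zero_apply] at h3 h4 ⊢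
    linarith
  · exact key 1 (by norm_num) h1

theorem zeroCount_eq (hW : RegularWeights p) (Hu : IsSolution p (lam • u) u m) (hu : u ≠ 0)
    (Hv : IsSolution p (lam • v) v n) (hv : v ≠ 0) : zeroCount u = zeroCount v :=
  le_antisymm (zeroCount_le hW Hu Hv le_rfl hu) (zeroCount_le hW Hv Hu le_rfl hv)

/-- All nonzero functions of an eigenspace have the same number of zeros. For a representative that
is even or odd under the half turn, zeros come in pairs, so the number is even. -/
theorem exists_isMode (hW : RegularWeights p) (H : IsSolution p (lam • u) u m) (h0 : u ≠ 0) :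
    ∃ k, IsMode p k lam u := by
  obtain ⟨f, l, σ, hσ, hf, hf0, hfσ⟩ := H.exists_symmetric hW h0
  have hσ0 : σ ≠ 0 := by rintro rfl; simp at hσ
  have h1 := zeroCount_eq_two_mul (u := f) fun θ => by rw [hfσ, mul_eq_zero_iff_left hσ0]
  have hfin : {θ | θ ∈ Ico 0 π ∧ f θ = 0}.Finite :=
    (hf.finite_zeros hW hf0 0 π).subset fun θ hθ => ⟨Ico_subset_Icc_self hθ.1, hθ.2⟩
  refine ⟨hfin.toFinset.card, H.isMode hW h0 ?_⟩
  rw [H.zeroCount_eq hW h0 hf hf0, h1, hfin.encard_eq_coe_toFinset_card]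

theorem exists_zero_of_ne_zero (hW : RegularWeights p) (H : IsSolution p (lam • u) u m)
    (hlam : lam ≠ 0) : ∃ θ ∈ Ioo 0 (2 * π), u θ = 0 := by
  obtain ⟨θ, hθ, h⟩ := exists_hasDerivAt_eq_zero two_pi_pos H.continuous_flux.continuousOn
    (by have := H.flux_periodic hW 0; rw [zero_add] at this; exact this.symm)
    fun θ _ => H.hasDerivAt_flux θ
  refine ⟨θ, hθ, ?_⟩
  have := (hW.wt_pos θ).ne'
  simpa [this, hlam] using h

/-- The flux is constant; by Rolle's theorem over a period it vanishes somewhere, hence everywhere.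
-/
theorem eq_const_of_eigenvalue_zero (hW : RegularWeights p) (H : IsSolution p ((0 : ℝ) • u) u m) :
    ∃ c, u = fun _ => c := by
  have hm : ∀ θ, m θ = m 0 := fun θ =>
    is_const_of_deriv_eq_zero (fun θ => (H.hasDerivAt_flux θ).differentiableAt)
      (fun θ => by rw [(H.hasDerivAt_flux θ).deriv]; simp) θ 0
  obtain ⟨ξ, -, h⟩ := exists_hasDerivAt_eq_zero two_pi_pos H.continuous.continuousOn
    (by have := H.periodic 0; rw [zero_add] at this; exact this.symm) fun θ _ => H.hasDerivAt θ
  have hm0 : m 0 = 0 := by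
    rw [← hm ξ]
    exact (mul_eq_zero.1 h).resolve_left (hW.dualWt_pos ξ).ne'
  refine ⟨u 0, funext fun θ => ?_⟩
  exact is_const_of_deriv_eq_zero (fun θ => (H.hasDerivAt θ).differentiableAt)
    (fun θ => by rw [H.deriv_eq, hm, hm0, mul_zero]) θ 0

end IsSolution

/-! ### The eigenvalue 1, and the eigenvalues of index at least two -/

section SupportOfPoints

variable {N : Seminorm ℝ (ℝ × ℝ)} {α : ℝ}

theorem isSolution_det_dual (hp : IsUnitCircleParam N α p) (x : ℝ × ℝ) :
    IsSolution p (fun θ => det x (dual p θ)) (fun θ => det x (dual p θ))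
      (fun θ => -det x (p θ)) where
  periodic θ := by
    have := hp.dual_antiperiodic.periodic_two_mul
    simp only [this θ]
  hasDerivAt θ := (HasDerivAt.det (hasDerivAt_const θ x) (hp.hasDerivAt_dual θ)).congr_deriv (by
    rw [det_smul_right]
    simp only [det, Prod.fst_zero, Prod.snd_zero]
    ring)
  hasDerivAt_flux θ := (HasDerivAt.det (hasDerivAt_const θ x) (hp.hasDerivAt θ)).neg.congr_deriv (by
    rw [hp.deriv_eq, det_smul_right]
    simp only [det, Prod.fst_zero, Prod.snd_zero]
    ring)

/-- The curve `u p + m q` has zero derivative: it is a single point, and `u` is its support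
function. -/
theorem exists_eq_det_dual (hp : IsUnitCircleParam N α p) (H : IsSolution p u u m) :
    ∃ x : ℝ × ℝ, u = fun θ => det x (dual p θ) := by
  let V : ℝ → ℝ × ℝ := fun θ => u θ • p θ + m θ • dual p θ
  have hV : ∀ θ, HasDerivAt V 0 θ := fun θ => by
    refine (((H.hasDerivAt θ).smul (hp.hasDerivAt θ)).add
      ((H.hasDerivAt_flux θ).smul (hp.hasDerivAt_dual θ))).congr_deriv ?_
    rw [hp.deriv_eq]
    ext
    · simp only [Prod.fst_add, Prod.smul_fst, smul_eq_mul, Prod.fst_zero]; ring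
    · simp only [Prod.snd_add, Prod.smul_snd, smul_eq_mul, Prod.snd_zero]; ring
  refine ⟨V 0, funext fun θ => ?_⟩
  rw [is_const_of_deriv_eq_zero (fun θ => (hV θ).differentiableAt) (fun θ => (hV θ).deriv) 0 θ]
  have h1 := hp.det_dual θ
  simp only [det] at h1
  simp only [V, det, Prod.fst_add, Prod.smul_fst, Prod.snd_add, Prod.smul_snd, smul_eq_mul]
  linear_combination (-u θ) * h1

theorem zeroCount_det_dual_le (hp : IsUnitCircleParam N α p) :
    zeroCount (fun θ => det (dual p 0) (dual p θ)) ≤ 2 := by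
  have hsub : {θ | θ ∈ Ico 0 (2 * π) ∧ det (dual p 0) (dual p θ) = 0} ⊆ {0, π} := by
    rintro θ ⟨hθ, h0⟩
    obtain ⟨c, hc, heq⟩ := hp.det_dual_dual 0 θ
    rw [heq, sub_zero] at h0
    have hs := (mul_eq_zero.1 h0).resolve_left hc.ne'
    by_contra hcon
    simp only [mem_insert_iff, mem_singleton_iff, not_or] at hcon
    rcases lt_or_gt_of_ne hcon.2 with hlt | hgt
    · exact (sin_pos_of_pos_of_lt_pi (lt_of_le_of_ne hθ.1 (Ne.symm hcon.1)) hlt).ne' hs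
    · have := sin_pos_of_pos_of_lt_pi (x := θ - π) (by linarith) (by linarith [hθ.2])
      rw [sin_sub_pi, hs, neg_zero] at this
      exact lt_irrefl _ this
  exact (encard_le_encard hsub).trans (encard_pair pi_ne_zero.symm).le

/-- An eigenvalue at most 1 would allow no more zeros than the support function of the point `q 0`
has, that is, at most two. -/
theorem one_lt_of_two_le_index (hp : IsUnitCircleParam N α p) {k : ℕ} (hk : 2 ≤ k)
    (hu : IsMode p k lam u) : 1 < lam := by
  by_contra! hle
  have hW := hp.regularWeights
  have Hv := isSolution_det_dual hp (dual p 0)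
  rw [← one_smul ℝ (fun θ => det (dual p 0) (dual p θ))] at Hv
  have h1 := IsSolution.zeroCount_le hW (hu.isSolution hW) (by simpa using! Hv) hle hu.ne_zero
  have h2 : zeroCount u = 2 * k := hu.index
  have h3 : (2 * k : ℕ∞) ≤ 2 := h2 ▸ h1.trans (zeroCount_det_dual_le hp)
  have h4 : 2 * k ≤ 2 := by exact_mod_cast h3
  omega

theorem exists_zero_forall_Ioo_ne (hu : ∀ θ, u (θ + π) = 0 ↔ u θ = 0) (h2 : zeroCount u = 2) :
    ∃ a, u a = 0 ∧ ∀ θ ∈ Ioo a (a + π), u θ ≠ 0 := by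
  rw [zeroCount_eq_two_mul hu] at h2
  have h1 : {θ | θ ∈ Ico 0 π ∧ u θ = 0}.encard = 1 := by
    generalize {θ | θ ∈ Ico 0 π ∧ u θ = 0}.encard = e at h2
    induction e using ENat.recTopCoe with
    | top => simp at h2
    | coe e =>
      have : 2 * e = 2 := by exact_mod_cast h2
      have : e = 1 := by omega
      simp [this]
  obtain ⟨a, ha⟩ := encard_eq_one.1 h1
  have haZ : a ∈ {θ | θ ∈ Ico 0 π ∧ u θ = 0} := ha ▸ mem_singleton a
  refine ⟨a, haZ.2, fun θ hθ h0 => ?_⟩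
  rcases lt_or_ge θ π with hlt | hge
  · have : θ ∈ ({a} : Set ℝ) := ha ▸ ⟨⟨haZ.1.1.trans hθ.1.le, hlt⟩, h0⟩
    exact hθ.1.ne' this
  · have : θ - π ∈ ({a} : Set ℝ) := by
      rw [← ha]
      refine ⟨⟨by linarith, by linarith [hθ.2, haZ.1.2]⟩, ?_⟩
      rw [← hu, sub_add_cancel, h0]
    have : θ - π = a := this
    linarith [hθ.2]

/-- Eigenfunctions which are orthogonal to the constants and to the support functions of points have
index at least two. -/
theorem two_le_index (hp : IsUnitCircleParam N α p) {k : ℕ} (hu : IsMode p k lam u)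
    (h0 : lam ≠ 0) (h1 : lam ≠ 1) : 2 ≤ k := by
  have hW := hp.regularWeights
  have H := hu.isSolution hW
  have hcount : zeroCount u = 2 * k := hu.index
  by_contra! hlt
  rcases Nat.lt_succ_iff_lt_or_eq.1 hlt with hk | rfl
  · obtain rfl : k = 0 := by omega
    obtain ⟨θ, hθ, hθ0⟩ := H.exists_zero_of_ne_zero hW h0
    rw [Nat.cast_zero, mul_zero, zeroCount, encard_eq_zero] at hcount
    have : θ ∈ {θ | θ ∈ Ico 0 (2 * π) ∧ u θ = 0} := ⟨Ioo_subset_Ico_self hθ, hθ0⟩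
    rw [hcount] at this
    exact this
  -- An even or odd representative with two zeros has them exactly `π` apart, as does the support
  -- function of a point. This makes the two sets of zeros coincide.
  · obtain ⟨f, l, σ, hσ, Hf, hf0, hfσ⟩ := H.exists_symmetric hW hu.ne_zero
    have hσ0 : σ ≠ 0 := by rintro rfl; simp at hσ
    have hc : zeroCount f = 2 := by
      rw [← H.zeroCount_eq hW hu.ne_zero Hf hf0, hcount]
      simp
    obtain ⟨a, ha, hne⟩ := exists_zero_forall_Ioo_ne (u := f)
      (fun θ => by rw [hfσ, mul_eq_zero_iff_left hσ0]) hc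
    have hb : f (a + π) = 0 := by rw [hfσ, ha, mul_zero]
    have hlt : a < a + π := by linarith [pi_pos]
    -- the Wronskian with the support function of the point `q a` vanishes at `a` and `a + π`
    have Hv := isSolution_det_dual hp (dual p a)
    have hva : det (dual p a) (dual p a) = 0 := det_self _
    have hvb : det (dual p a) (dual p (a + π)) = 0 := by
      rw [hp.dual_antiperiodic, det_neg_right, det_self, neg_zero]
    obtain ⟨ξ, hξ, h⟩ := exists_hasDerivAt_eq_zero hlt
      (fun t _ => (IsSolution.hasDerivAt_wronskian Hf Hv t).continuousAt.continuousWithinAt)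
      (by simp only [hva, hvb, ha, hb]; ring)
      fun t _ => IsSolution.hasDerivAt_wronskian Hf Hv t
    obtain ⟨c, hcpos, heq⟩ := hp.det_dual_dual a ξ
    have hs := sin_pos_of_pos_of_lt_pi (x := ξ - a) (by linarith [hξ.1]) (by linarith [hξ.2])
    rw [heq] at h
    simp only [Pi.smul_apply, smul_eq_mul] at h
    have h2 : wt p ξ * (1 - lam) * f ξ * (c * sin (ξ - a)) = 0 := by linarith
    refine absurd h2 (mul_ne_zero (mul_ne_zero (mul_ne_zero (hW.wt_pos ξ).ne'
      (sub_ne_zero.2 h1.symm)) (hne ξ hξ)) (mul_pos hcpos hs).ne')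

end SupportOfPoints

end NormedPlane

namespace NormedPlane

/-! ### Solving `T g = h`, with bounds -/

section Integrals

open MeasureTheory

theorem hasDerivAt_integral_zero {f : ℝ → ℝ} (hf : Continuous f) (θ : ℝ) :
    HasDerivAt (fun t => ∫ s in (0 : ℝ)..t, f s) (f θ) θ :=
  (hf.integral_hasStrictDerivAt 0 θ).hasDerivAt

theorem abs_le_integral_abs_deriv {f f' : ℝ → ℝ} {c : ℝ} (hf : ∀ θ, HasDerivAt f (f' θ) θ)
    (hf' : Continuous f') {ξ θ : ℝ} (hξ : ξ ∈ Icc 0 c) (hθ : θ ∈ Icc 0 c) (h0 : f ξ = 0) :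
    |f θ| ≤ ∫ t in (0 : ℝ)..c, |f' t| := by
  have hc : 0 ≤ c := hξ.1.trans hξ.2
  have h1 := intervalIntegral.integral_eq_sub_of_hasDerivAt (fun t _ => hf t)
    (hf'.intervalIntegrable ξ θ)
  rw [h0, sub_zero] at h1
  rw [← h1]
  have h2 := intervalIntegral.norm_integral_le_abs_integral_norm (f := f') (a := ξ) (b := θ)
    (μ := volume)
  have h3 : |∫ t in ξ..θ, ‖f' t‖| ≤ |∫ t in (0 : ℝ)..c, ‖f' t‖| := by
    refine intervalIntegral.abs_integral_mono_interval ?_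
      (Eventually.of_forall fun t => norm_nonneg _) (hf'.norm.intervalIntegrable _ _)
    rw [uIoc_of_le hc]
    exact Ioc_subset_Ioc (le_min hξ.1 hθ.1) (max_le hξ.2 hθ.2)
  have h4 : 0 ≤ ∫ t in (0 : ℝ)..c, ‖f' t‖ :=
    intervalIntegral.integral_nonneg hc fun t _ => norm_nonneg _
  rw [abs_of_nonneg h4] at h3
  exact h2.trans h3

theorem exists_zero_of_integral_eq_zero {f : ℝ → ℝ} {c : ℝ} (hc : 0 < c) (hf : Continuous f)
    (h0 : ∫ t in (0 : ℝ)..c, f t = 0) : ∃ ξ ∈ Icc 0 c, f ξ = 0 := by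
  obtain ⟨ξ, hξ, h⟩ := exists_hasDerivAt_eq_zero hc
    (fun t _ => (hasDerivAt_integral_zero hf t).continuousAt.continuousWithinAt)
    (by simp [h0]) fun t _ => hasDerivAt_integral_zero hf t
  exact ⟨ξ, Ioo_subset_Icc_self hξ, h⟩

/-- A continuous periodic function with mean zero has a periodic primitive. -/
theorem exists_periodic_primitive {f : ℝ → ℝ} {c : ℝ} (hf : Continuous f)
    (hp : Function.Periodic f c) (h0 : ∫ t in (0 : ℝ)..c, f t = 0) :
    ∃ F : ℝ → ℝ, Function.Periodic F c ∧ ∀ θ, HasDerivAt F (f θ) θ := by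
  refine ⟨fun t => ∫ s in (0 : ℝ)..t, f s, fun t => ?_, hasDerivAt_integral_zero hf⟩
  have h1 := hp.intervalIntegral_add_eq t 0
  rw [zero_add, h0] at h1
  have h2 := intervalIntegral.integral_add_adjacent_intervals (hf.intervalIntegrable (μ := volume) 0 t)
    (hf.intervalIntegrable t (t + c))
  rw [h1, add_zero] at h2
  exact h2.symm

/-- A weighted mean can be made to vanish by adding a constant. -/
theorem exists_integral_add_const_mul_eq_zero {f w : ℝ → ℝ} {c : ℝ} (hf : Continuous f)
    (hw : Continuous w) (hI : ∫ t in (0 : ℝ)..c, w t ≠ 0) :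
    ∃ C, ∫ t in (0 : ℝ)..c, (f t + C) * w t = 0 := by
  refine ⟨-(∫ t in (0 : ℝ)..c, f t * w t) / ∫ t in (0 : ℝ)..c, w t, ?_⟩
  simp only [add_mul]
  rw [intervalIntegral.integral_add (f := fun t => f t * w t) (g := fun t => _ * w t)
    ((hf.mul hw).intervalIntegrable _ _) ((continuous_const.mul hw).intervalIntegrable _ _),
    intervalIntegral.integral_const_mul]
  field_simp
  ring

end Integrals

variable {p : ℝ → ℝ × ℝ} {h g m : ℝ → ℝ}

namespace RegularWeights

theorem wt_periodic_two_pi (hW : RegularWeights p) : Function.Periodic (wt p) (2 * π) := by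
  have := hW.wt_periodic.nat_mul 2
  exact_mod_cast this

theorem dualWt_periodic_two_pi (hW : RegularWeights p) : Function.Periodic (dualWt p) (2 * π) := by
  have := hW.dualWt_periodic.nat_mul 2
  exact_mod_cast this

theorem integral_wt_pos (hW : RegularWeights p) : 0 < ∫ t in (0 : ℝ)..2 * π, wt p t :=
  intervalIntegral.intervalIntegral_pos_of_pos (hW.continuous_wt.intervalIntegrable _ _) hW.wt_pos
    two_pi_pos

theorem integral_dualWt_pos (hW : RegularWeights p) : 0 < ∫ t in (0 : ℝ)..2 * π, dualWt p t :=
  intervalIntegral.intervalIntegral_pos_of_pos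
    (hW.contDiff_dualWt.continuous.intervalIntegrable _ _) hW.dualWt_pos two_pi_pos

theorem exists_isSolution (hW : RegularWeights p) (hh : h ∈ L0 p) :
    ∃ g m, IsSolution p h g m ∧ g ∈ D0 p := by
  have hw := hW.continuous_wt
  have hz := hW.contDiff_dualWt.continuous
  obtain ⟨m₀, hm₀, hdm₀⟩ := exists_periodic_primitive (f := fun θ => -(wt p θ * h θ)) (c := 2 * π)
    (hw.mul hh.1).neg (fun θ => by simp only [hW.wt_periodic_two_pi θ, hh.2.1 θ]) (by
      rw [intervalIntegral.integral_neg, neg_eq_zero]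
      simpa only [mul_comm] using hh.2.2)
  have hcm₀ : Continuous m₀ := continuous_iff_continuousAt.2 fun θ => (hdm₀ θ).continuousAt
  -- The mean-zero condition on `h` makes the flux periodic. The constant `C` in the flux makes `g`
  -- periodic, and the constant `D` below puts `g` in `L0`.
  obtain ⟨C, hC⟩ := exists_integral_add_const_mul_eq_zero hcm₀ hz hW.integral_dualWt_pos.ne'
  obtain ⟨g₀, hg₀, hdg₀⟩ := exists_periodic_primitive (f := fun θ => (m₀ θ + C) * dualWt p θ)
    (c := 2 * π) ((hcm₀.add continuous_const).mul hz)
    (fun θ => by simp only [hW.dualWt_periodic_two_pi θ, hm₀ θ]) hC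
  have H₀ : IsSolution p h g₀ (fun θ => m₀ θ + C) :=
    ⟨hg₀, fun θ => (hdg₀ θ).congr_deriv (mul_comm _ _), fun θ => (hdm₀ θ).add_const C⟩
  obtain ⟨D, hD⟩ := exists_integral_add_const_mul_eq_zero H₀.continuous hw hW.integral_wt_pos.ne'
  have H := H₀.add_const D
  exact ⟨_, _, H, ⟨H.continuous, H.periodic, hD⟩, H.contDiff hW hh.1⟩

theorem isSolution_of_mem_D0 (hW : RegularWeights p) (hg : g ∈ D0 p) :
    IsSolution p (T p g) g (fun θ => deriv g θ / dualWt p θ) :=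
  IsSolution.of_contDiff hW hg.2 hg.1.2.1

theorem continuous_T (hW : RegularWeights p) (hg : ContDiff ℝ 2 g) : Continuous (T p g) := by
  rw [show (2 : WithTop ℕ∞) = 1 + 1 by norm_num, contDiff_succ_iff_deriv] at hg
  have hm : ContDiff ℝ 1 fun θ => deriv g θ / dualWt p θ :=
    hg.2.2.div hW.contDiff_dualWt fun θ => (hW.dualWt_pos θ).ne'
  exact ((hW.continuous_wt.inv₀ fun θ => (hW.wt_pos θ).ne').mul
    (contDiff_one_iff_deriv.1 hm).2).neg

end RegularWeights

namespace IsSolution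

theorem integral_mul_wt (hW : RegularWeights p) (H : IsSolution p h g m) (hh : Continuous h) :
    ∫ θ in (0 : ℝ)..2 * π, h θ * wt p θ = 0 := by
  have h1 := intervalIntegral.integral_eq_sub_of_hasDerivAt
    (fun t (_ : t ∈ uIcc 0 (2 * π)) => H.hasDerivAt_flux t)
    ((hW.continuous_wt.mul hh).neg.intervalIntegrable _ _)
  have h2 := H.flux_periodic hW 0
  rw [zero_add] at h2
  rw [h2, sub_self, intervalIntegral.integral_neg, neg_eq_zero] at h1
  simpa only [mul_comm] using h1

theorem mem_L0 (hW : RegularWeights p) (H : IsSolution p h g m) (hh : Continuous h)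
    (hper : Function.Periodic h (2 * π)) : h ∈ L0 p :=
  ⟨hh, hper, H.integral_mul_wt hW hh⟩

theorem T_periodic (hW : RegularWeights p) (H : IsSolution p h g m) :
    Function.Periodic h (2 * π) := by
  intro θ
  have h1 := (H.hasDerivAt_flux (θ + 2 * π)).comp_add_const θ (2 * π)
  have h2 : (fun t => m (t + 2 * π)) = m := funext (H.flux_periodic hW)
  rw [h2] at h1
  have h3 := h1.unique (H.hasDerivAt_flux θ)
  rw [hW.wt_periodic_two_pi, neg_inj] at h3
  exact mul_left_cancel₀ (hW.wt_pos θ).ne' h3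

/-- By Rolle's theorem for `g` the flux vanishes somewhere in the period, so it is bounded by the
integral of the absolute value of its derivative. -/
theorem abs_flux_le (hW : RegularWeights p) (H : IsSolution p h g m) (hh : Continuous h) (θ : ℝ) :
    |m θ| ≤ ∫ t in (0 : ℝ)..2 * π, |h t| * wt p t := by
  obtain ⟨ξ, hξ, h0⟩ := exists_hasDerivAt_eq_zero two_pi_pos H.continuous.continuousOn
    (by have := H.periodic 0; rw [zero_add] at this; exact this.symm) fun θ _ => H.hasDerivAt θ
  obtain ⟨τ, hτ, hm⟩ := (H.flux_periodic hW).exists_mem_Ico₀ two_pi_pos θ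
  have h1 := abs_le_integral_abs_deriv H.hasDerivAt_flux (hW.continuous_wt.mul hh).neg
    (Ioo_subset_Icc_self hξ) (Ico_subset_Icc_self hτ)
    ((mul_eq_zero.1 h0).resolve_left (hW.dualWt_pos ξ).ne')
  rw [hm]
  refine h1.trans_eq ?_
  congr 1
  funext t
  rw [abs_neg, abs_mul, abs_of_pos (hW.wt_pos t), mul_comm]

theorem abs_le (hW : RegularWeights p) (H : IsSolution p h g m) (hh : Continuous h)
    (hg : g ∈ L0 p) (θ : ℝ) :
    |g θ| ≤ (∫ t in (0 : ℝ)..2 * π, dualWt p t) * ∫ t in (0 : ℝ)..2 * π, |h t| * wt p t := by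
  obtain ⟨ξ, hξ, h0⟩ := exists_zero_of_integral_eq_zero two_pi_pos (hg.1.mul hW.continuous_wt) hg.2.2
  obtain ⟨τ, hτ, hgτ⟩ := H.periodic.exists_mem_Ico₀ two_pi_pos θ
  have hz := hW.contDiff_dualWt.continuous
  have h1 := abs_le_integral_abs_deriv H.hasDerivAt (hz.mul H.continuous_flux)
    hξ (Ico_subset_Icc_self hτ) ((mul_eq_zero.1 h0).resolve_right (hW.wt_pos ξ).ne')
  rw [hgτ, ← intervalIntegral.integral_mul_const]
  refine h1.trans (intervalIntegral.integral_mono two_pi_pos.le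
    ((hz.mul H.continuous_flux).abs.intervalIntegrable _ _)
    ((hz.mul continuous_const).intervalIntegrable _ _) fun t => ?_)
  simp only [abs_mul]
  rw [abs_of_pos (hW.dualWt_pos t)]
  exact mul_le_mul_of_nonneg_left (H.abs_flux_le hW hh t) (hW.dualWt_pos t).le

end IsSolution

namespace RegularWeights

theorem eq_zero_of_const_mem_L0 (hW : RegularWeights p) {c : ℝ} (hc : (fun _ => c) ∈ L0 p) :
    c = 0 := by
  have h := hc.2.2
  rw [intervalIntegral.integral_const_mul] at h
  exact (mul_eq_zero.1 h).resolve_right hW.integral_wt_pos.ne'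

/-- The image has mean zero because it is, up to sign, the weighted derivative of a periodic flux.
The kernel consists of constants, and the only constant in `L0` is 0. -/
theorem bijOn_T (hW : RegularWeights p) : BijOn (T p) (D0 p) (L0 p) := by
  refine ⟨fun g hg => ?_, fun g₁ hg₁ g₂ hg₂ heq => ?_, fun h hh => ?_⟩
  · have H := hW.isSolution_of_mem_D0 hg
    exact H.mem_L0 hW (hW.continuous_T hg.2) (H.T_periodic hW)
  · have H := (hW.isSolution_of_mem_D0 hg₁).sub (hW.isSolution_of_mem_D0 hg₂)
    rw [heq, sub_self, ← zero_smul ℝ (g₁ - g₂)] at H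
    obtain ⟨c, hc⟩ := H.eq_const_of_eigenvalue_zero hW
    have hw := hW.continuous_wt
    have hmem : (fun _ => c) ∈ L0 p := by
      rw [← hc]
      refine ⟨hg₁.1.1.sub hg₂.1.1, hg₁.1.2.1.sub hg₂.1.2.1, ?_⟩
      simp only [Pi.sub_apply, sub_mul]
      rw [intervalIntegral.integral_sub (f := fun t => g₁ t * wt p t)
        (g := fun t => g₂ t * wt p t) ((hg₁.1.1.mul hw).intervalIntegrable _ _)
        ((hg₂.1.1.mul hw).intervalIntegrable _ _), hg₁.1.2.2, hg₂.1.2.2, sub_zero]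
    rw [hW.eq_zero_of_const_mem_L0 hmem] at hc
    exact sub_eq_zero.1 hc
  · obtain ⟨g, m, H, hg⟩ := hW.exists_isSolution hh
    exact ⟨g, hg, H.T_eq hW⟩

theorem S_mem (hW : RegularWeights p) (hh : h ∈ L0 p) : S p h ∈ D0 p :=
  Function.invFunOn_mem (hW.bijOn_T.surjOn hh)

theorem T_S (hW : RegularWeights p) (hh : h ∈ L0 p) : T p (S p h) = h :=
  Function.invFunOn_eq (hW.bijOn_T.surjOn hh)

theorem isSolution_S (hW : RegularWeights p) (hh : h ∈ L0 p) :
    IsSolution p h (S p h) (fun θ => deriv (S p h) θ / dualWt p θ) := by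
  have := hW.isSolution_of_mem_D0 (hW.S_mem hh)
  rwa [hW.T_S hh] at this

theorem S_eq (hW : RegularWeights p) (hh : h ∈ L0 p) (H : IsSolution p h g m) (hg : g ∈ L0 p) :
    S p h = g :=
  hW.bijOn_T.injOn (hW.S_mem hh) ⟨hg, H.contDiff hW hh.1⟩ (by rw [hW.T_S hh, H.T_eq hW])

end RegularWeights

end NormedPlane

/-! ### `L0` as an inner product space, and `S` as a compact symmetric operator -/

namespace NormedPlane

variable {p : ℝ → ℝ × ℝ}

/-- `L₀` as a space of functions. -/
def L0Submodule (hW : RegularWeights p) : Submodule ℝ (ℝ → ℝ) where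
  carrier := L0 p
  zero_mem' := ⟨continuous_const, fun _ => rfl, by simp⟩
  add_mem' {f g} hf hg := by
    refine ⟨hf.1.add hg.1, hf.2.1.add hg.2.1, ?_⟩
    simp only [Pi.add_apply, add_mul]
    rw [intervalIntegral.integral_add (f := fun t => f t * wt p t) (g := fun t => g t * wt p t)
      ((hf.1.mul hW.continuous_wt).intervalIntegrable _ _)
      ((hg.1.mul hW.continuous_wt).intervalIntegrable _ _), hf.2.2, hg.2.2, add_zero]
  smul_mem' c f hf := by
    refine ⟨hf.1.const_smul c, hf.2.1.smul c, ?_⟩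
    simp only [Pi.smul_apply, smul_eq_mul, mul_assoc]
    rw [intervalIntegral.integral_const_mul, hf.2.2, mul_zero]

/-- `L₀` as a type, to carry the norm of the inner product `ip p`. -/
def L0Space (hW : RegularWeights p) : Type := L0Submodule hW

namespace L0Space

variable {hW : RegularWeights p}

instance : AddCommGroup (L0Space hW) := inferInstanceAs (AddCommGroup (L0Submodule hW))

instance : Module ℝ (L0Space hW) := inferInstanceAs (Module ℝ (L0Submodule hW))

/-- The underlying function. -/
def toFun : L0Space hW →ₗ[ℝ] ℝ → ℝ := (L0Submodule hW).subtype

/-- An element of `L₀` as a vector of the inner product space. -/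
def mk (hW : RegularWeights p) {f : ℝ → ℝ} (hf : f ∈ L0 p) : L0Space hW :=
  (⟨f, hf⟩ : L0Submodule hW)

@[simp] theorem toFun_mk {f : ℝ → ℝ} (hf : f ∈ L0 p) : toFun (mk hW hf) = f := rfl

theorem mem (x : L0Space hW) : toFun x ∈ L0 p := Subtype.property (p := fun f => f ∈ L0 p) x

theorem toFun_injective : Function.Injective (toFun : L0Space hW → ℝ → ℝ) := Subtype.val_injective

theorem continuous (x : L0Space hW) : Continuous (toFun x) := x.mem.1

theorem continuous_mul_mul (hW : RegularWeights p) {f g : ℝ → ℝ} (hf : Continuous f)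
    (hg : Continuous g) : Continuous fun θ => f θ * g θ * wt p θ :=
  (hf.mul hg).mul hW.continuous_wt

theorem ip_self_nonneg (hW : RegularWeights p) (f : ℝ → ℝ) : 0 ≤ ip p f f :=
  intervalIntegral.integral_nonneg two_pi_pos.le fun t _ =>
    mul_nonneg (mul_self_nonneg _) (hW.wt_pos t).le

theorem ip_self_pos (hW : RegularWeights p) {f : ℝ → ℝ} (hf : Continuous f)
    (hper : Function.Periodic f (2 * π)) (h0 : f ≠ 0) : 0 < ip p f f := by
  obtain ⟨θ, hθ⟩ := Function.ne_iff.1 h0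
  obtain ⟨τ, hτ, hfτ⟩ := hper.exists_mem_Ico₀ two_pi_pos θ
  refine intervalIntegral.integral_pos two_pi_pos (continuous_mul_mul hW hf hf).continuousOn
    (fun t _ => mul_nonneg (mul_self_nonneg _) (hW.wt_pos t).le) ⟨τ, Ico_subset_Icc_self hτ, ?_⟩
  refine mul_pos (mul_self_pos.2 ?_) (hW.wt_pos τ)
  rw [← hfτ]
  exact hθ

/-- The inner product `ip p` on `L₀`. -/
@[reducible] def core (hW : RegularWeights p) : InnerProductSpace.Core ℝ (L0Space hW) where
  inner x y := ip p (toFun x) (toFun y)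
  conj_inner_symm x y := by
    simp only [ip, conj_trivial, mul_comm (toFun x _)]
  re_inner_nonneg x := ip_self_nonneg hW _
  add_left x y z := by
    simp only [ip, map_add, Pi.add_apply, add_mul]
    exact intervalIntegral.integral_add
      ((continuous_mul_mul hW x.continuous z.continuous).intervalIntegrable _ _)
      ((continuous_mul_mul hW y.continuous z.continuous).intervalIntegrable _ _)
  smul_left x y r := by
    simp only [ip, map_smul, Pi.smul_apply, smul_eq_mul, mul_assoc, conj_trivial]
    exact intervalIntegral.integral_const_mul _ _
  definite x hx := by
    by_contra h0
    have : toFun x ≠ 0 := fun h => h0 (toFun_injective (by rw [h, map_zero]))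
    exact (ip_self_pos hW x.continuous x.mem.2.1 this).ne' hx

instance : NormedAddCommGroup (L0Space hW) := (core hW).toNormedAddCommGroup

instance : InnerProductSpace ℝ (L0Space hW) := InnerProductSpace.ofCore (core hW).toCore

open scoped InnerProductSpace

theorem inner_eq (x y : L0Space hW) : ⟪x, y⟫_ℝ = ip p (toFun x) (toFun y) := rfl

theorem norm_sq_eq (x : L0Space hW) : ‖x‖ ^ 2 = ip p (toFun x) (toFun x) := by
  rw [← inner_eq, real_inner_self_eq_norm_sq]

/-- The Cauchy-Schwarz inequality against the constants. -/
theorem integral_abs_mul_wt_le (x : L0Space hW) :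
    ∫ t in (0 : ℝ)..2 * π, |toFun x t| * wt p t ≤ √(∫ t in (0 : ℝ)..2 * π, wt p t) * ‖x‖ := by
  have hw := hW.continuous_wt
  have hI := hW.integral_wt_pos
  set I := ∫ t in (0 : ℝ)..2 * π, wt p t
  set A := ∫ t in (0 : ℝ)..2 * π, |toFun x t| * wt p t
  have hx := x.continuous
  -- `A / I` is the weighted mean of `|x|`; the inequality is the nonnegativity of its variance.
  have h1 : 0 ≤ ∫ t in (0 : ℝ)..2 * π, (|toFun x t| - A / I) ^ 2 * wt p t :=
    intervalIntegral.integral_nonneg two_pi_pos.le fun t _ =>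
      mul_nonneg (sq_nonneg _) (hW.wt_pos t).le
  have h2 : ∫ t in (0 : ℝ)..2 * π, (|toFun x t| - A / I) ^ 2 * wt p t =
      ip p (toFun x) (toFun x) - 2 * (A / I) * A + (A / I) ^ 2 * I := by
    have h3 : ∀ t, (|toFun x t| - A / I) ^ 2 * wt p t = toFun x t * toFun x t * wt p t -
        2 * (A / I) * (|toFun x t| * wt p t) + (A / I) ^ 2 * wt p t := by
      intro t
      linear_combination wt p t * sq_abs (toFun x t)
    simp only [h3]
    rw [intervalIntegral.integral_add, intervalIntegral.integral_sub,
      intervalIntegral.integral_const_mul, intervalIntegral.integral_const_mul, ip]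
    all_goals exact Continuous.intervalIntegrable (by fun_prop) _ _
  rw [h2, ← norm_sq_eq] at h1
  have h4 : A ^ 2 ≤ I * ‖x‖ ^ 2 := by
    have h5 : ‖x‖ ^ 2 - 2 * (A / I) * A + (A / I) ^ 2 * I = ‖x‖ ^ 2 - A ^ 2 / I := by
      field_simp
      ring
    rw [h5, sub_nonneg, div_le_iff₀ hI] at h1
    linarith
  refine le_of_sq_le_sq ?_ (by positivity)
  rw [mul_pow, Real.sq_sqrt hI.le]
  exact h4

/-- The operator `S` on the function space. -/
def solve (hW : RegularWeights p) : L0Space hW →ₗ[ℝ] L0Space hW where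
  toFun x := mk hW (hW.S_mem x.mem).1
  map_add' x y := by
    apply toFun_injective
    rw [toFun_mk, map_add toFun (mk hW _), toFun_mk, toFun_mk]
    have H := (hW.isSolution_S x.mem).add (hW.isSolution_S y.mem)
    rw [← map_add] at H
    exact hW.S_eq (x + y).mem H ((L0Submodule hW).add_mem (hW.S_mem x.mem).1 (hW.S_mem y.mem).1)
  map_smul' c x := by
    apply toFun_injective
    rw [RingHom.id_apply, toFun_mk, map_smul toFun c (mk hW _), toFun_mk]
    have H := (hW.isSolution_S x.mem).smul c
    rw [← map_smul] at H
    exact hW.S_eq (c • x).mem H ((L0Submodule hW).smul_mem c (hW.S_mem x.mem).1)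

theorem toFun_solve (x : L0Space hW) : toFun (solve hW x) = S p (toFun x) := rfl

/-- The bound of the flux in terms of the norm. -/
def fluxBound (p : ℝ → ℝ × ℝ) : ℝ := √(∫ t in (0 : ℝ)..2 * π, wt p t)

/-- The bound of a solution in terms of the norm. -/
def solveBound (p : ℝ → ℝ × ℝ) : ℝ := (∫ t in (0 : ℝ)..2 * π, dualWt p t) * fluxBound p

theorem abs_flux_solve_le (x : L0Space hW) (θ : ℝ) :
    |deriv (S p (toFun x)) θ / dualWt p θ| ≤ fluxBound p * ‖x‖ :=
  ((hW.isSolution_S x.mem).abs_flux_le hW x.continuous θ).trans x.integral_abs_mul_wt_le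

theorem abs_solve_le (x : L0Space hW) (θ : ℝ) : |S p (toFun x) θ| ≤ solveBound p * ‖x‖ := by
  refine ((hW.isSolution_S x.mem).abs_le hW x.continuous (hW.S_mem x.mem).1 θ).trans ?_
  rw [solveBound, mul_assoc]
  exact mul_le_mul_of_nonneg_left x.integral_abs_mul_wt_le hW.integral_dualWt_pos.le

/-- The Wronskian of the two solutions is periodic, so its derivative, which is the difference of
the two integrands, integrates to zero. -/
theorem isSymmetric_solve : (solve hW).IsSymmetric := by
  intro x y
  have Hx := hW.isSolution_S x.mem
  have Hy := hW.isSolution_S y.mem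
  have h1 := intervalIntegral.integral_eq_sub_of_hasDerivAt
    (fun t (_ : t ∈ uIcc 0 (2 * π)) => IsSolution.hasDerivAt_wronskian Hx Hy t)
    (Continuous.intervalIntegrable (hW.continuous_wt.mul
      ((Hx.continuous.mul y.continuous).sub (x.continuous.mul Hy.continuous))) _ _)
  have h2 : ∀ {f : ℝ → ℝ}, Function.Periodic f (2 * π) → f (2 * π) = f 0 := fun hf => by
    simpa using hf 0
  rw [h2 (Hx.flux_periodic hW), h2 (Hy.flux_periodic hW), h2 Hx.periodic, h2 Hy.periodic,
    sub_self] at h1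
  rw [inner_eq, inner_eq, toFun_solve, toFun_solve, ip, ip, ← sub_eq_zero, ← h1,
    ← intervalIntegral.integral_sub]
  · congr 1
    funext t
    ring
  · exact (continuous_mul_mul hW Hx.continuous y.continuous).intervalIntegrable _ _
  · exact (continuous_mul_mul hW x.continuous Hy.continuous).intervalIntegrable _ _

theorem isCompact_setOf_lipschitz (c C : ℝ) (K : NNReal) :
    IsCompact {f : C(ℝ, ℝ) | Function.Periodic f c ∧ (∀ x, |f x| ≤ C) ∧ LipschitzWith K f} := by
  have himg : ContinuousMap.toFun ''
      {f : C(ℝ, ℝ) | Function.Periodic f c ∧ (∀ x, |f x| ≤ C) ∧ LipschitzWith K f} =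
      {f : ℝ → ℝ | Function.Periodic f c ∧ (∀ x, |f x| ≤ C) ∧ LipschitzWith K f} := by
    ext f
    constructor
    · rintro ⟨f, hf, rfl⟩
      exact hf
    · intro hf
      exact ⟨⟨f, hf.2.2.continuous⟩, hf, rfl⟩
  refine ArzelaAscoli.isCompact_of_equicontinuous _ ?_ ?_
  · rw [himg]
    refine IsCompact.of_isClosed_subset (s := Set.pi univ fun _ : ℝ => Icc (-C) C)
      (isCompact_univ_pi fun _ => isCompact_Icc) ?_ fun f hf x _ => abs_le.1 (hf.2.1 x)
    have h1 : IsClosed {f : ℝ → ℝ | Function.Periodic f c} := by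
      simp only [Function.Periodic, Set.ofPred_forall]
      exact isClosed_iInter fun x => isClosed_eq (continuous_apply _) (continuous_apply _)
    have h2 : IsClosed {f : ℝ → ℝ | ∀ x, |f x| ≤ C} := by
      simp only [Set.ofPred_forall]
      exact isClosed_iInter fun x => isClosed_le (continuous_apply x).abs continuous_const
    have h3 : IsClosed {f : ℝ → ℝ | LipschitzWith K f} := by
      simp only [lipschitzWith_iff_dist_le_mul, Set.ofPred_forall]
      exact isClosed_iInter fun x => isClosed_iInter fun y =>
        isClosed_le ((continuous_apply x).dist (continuous_apply y)) continuous_const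
    exact h1.inter (h2.inter h3)
  · exact (LipschitzWith.uniformEquicontinuous _ K fun f => f.2.2.2).equicontinuous

/-- Equibounded, equi-Lipschitz families of functions of mean zero are compact. -/
theorem exists_isCompact (hW : RegularWeights p) (C : ℝ) (K : NNReal) :
    ∃ A : Set (L0Space hW), IsCompact A ∧
      ∀ x : L0Space hW, (∀ θ, |toFun x θ| ≤ C) → LipschitzWith K (toFun x) → x ∈ A := by
  have hw := hW.continuous_wt
  let B : Set C(ℝ, ℝ) := {f | Function.Periodic f (2 * π) ∧ (∀ x, |f x| ≤ C) ∧ LipschitzWith K f} ∩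
    {f | ∫ θ in (0 : ℝ)..2 * π, f θ * wt p θ = 0}
  have hB : IsCompact B := by
    refine (isCompact_setOf_lipschitz (2 * π) C K).inter_right (isClosed_eq ?_ continuous_const)
    refine intervalIntegral.continuous_parametric_intervalIntegral_of_continuous' ?_ _ _
    have : Continuous fun y : C(ℝ, ℝ) × ℝ => y.1 y.2 * wt p y.2 :=
      (continuous_fst.eval continuous_snd).mul (hw.comp continuous_snd)
    exact this
  -- `B` is compact in the compact-open topology, which is finer than the integral norm on it. So
  -- its image in `L0Space hW` is compact.
  let Φ : B → L0Space hW := fun f => mk hW ⟨f.1.continuous, f.2.1.1, f.2.2⟩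
  have hΦ : Continuous Φ := by
    refine continuous_iff_continuousAt.2 fun f₀ => tendsto_iff_norm_sub_tendsto_zero.2 ?_
    let F : C(ℝ, ℝ) → ℝ := fun f => ∫ θ in (0 : ℝ)..2 * π,
      (f θ - f₀.1 θ) * (f θ - f₀.1 θ) * wt p θ
    have hF : Continuous F := by
      refine intervalIntegral.continuous_parametric_intervalIntegral_of_continuous' ?_ _ _
      have : Continuous fun y : C(ℝ, ℝ) × ℝ => y.1 y.2 - f₀.1 y.2 :=
        (continuous_fst.eval continuous_snd).sub (f₀.1.continuous.comp continuous_snd)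
      exact ((this.mul this).mul (hw.comp continuous_snd) :)
    have h1 : ∀ f : B, ‖Φ f - Φ f₀‖ = √(F f.1) := fun f => by
      rw [← Real.sqrt_sq (norm_nonneg _), norm_sq_eq, map_sub]
      rfl
    have h2 : √(F f₀.1) = 0 := by simp [F]
    simp only [h1]
    have h3 : Continuous fun f : B => √(F f.1) := (hF.comp continuous_subtype_val).sqrt
    have := h3.tendsto f₀
    rwa [h2] at this
  have := isCompact_iff_compactSpace.1 hB
  refine ⟨range Φ, isCompact_range hΦ, fun x h1 h2 => ?_⟩
  exact ⟨⟨⟨toFun x, x.continuous⟩, ⟨x.mem.2.1, h1, h2⟩, x.mem.2.2⟩, rfl⟩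

theorem fluxBound_nonneg : 0 ≤ fluxBound p := Real.sqrt_nonneg _

theorem solveBound_nonneg (hW : RegularWeights p) : 0 ≤ solveBound p :=
  mul_nonneg hW.integral_dualWt_pos.le fluxBound_nonneg

/-- On the unit ball the solutions are bounded, and the flux bound times the maximum of `[q, q']` is
a common Lipschitz constant. -/
theorem isCompactOperator_solve (hW : RegularWeights p) : IsCompactOperator (solve hW) := by
  obtain ⟨Z, hZ, hz⟩ := exists_forall_abs_le_of_periodic hW.contDiff_dualWt.continuous pi_ne_zero
    hW.dualWt_periodic
  have hZK : 0 ≤ Z * fluxBound p := mul_nonneg hZ fluxBound_nonneg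
  obtain ⟨A, hA, hmem⟩ := exists_isCompact hW (solveBound p)
    (Z * fluxBound p).toNNReal
  refine ⟨A, hA, mem_of_superset (Metric.closedBall_mem_nhds 0 one_pos) fun x hx => ?_⟩
  rw [mem_closedBall_zero_iff] at hx
  refine hmem _ (fun θ => ?_) ?_
  · exact (x.abs_solve_le θ).trans (mul_le_of_le_one_right (solveBound_nonneg hW) hx)
  · have H := hW.isSolution_S x.mem
    refine lipschitzWith_of_nnnorm_deriv_le (fun θ => (H.hasDerivAt θ).differentiableAt) fun θ => ?_
    rw [← NNReal.coe_le_coe, coe_nnnorm, Real.coe_toNNReal _ hZK, toFun_solve, H.deriv_eq, Real.norm_eq_abs, abs_mul]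
    exact mul_le_mul (hz θ) ((x.abs_flux_solve_le θ).trans
      (mul_le_of_le_one_right fluxBound_nonneg hx)) (abs_nonneg _) hZ

/-- The compact operator `S` on the inner product space `L₀`. -/
def solveL (hW : RegularWeights p) : L0Space hW →L[ℝ] L0Space hW :=
  ⟨solve hW, (isCompactOperator_solve hW).continuous⟩

theorem toFun_solveL (x : L0Space hW) : toFun (solveL hW x) = S p (toFun x) := rfl

theorem toFun_solveL_pow (x : L0Space hW) (k : ℕ) :
    toFun ((solveL hW ^ k) x) = (S p)^[k] (toFun x) := by
  induction k generalizing x with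
  | zero => rfl
  | succ k ih =>
    rw [pow_succ, Function.iterate_succ_apply, ← toFun_solveL, ← ih]
    rfl

end L0Space

end NormedPlane

namespace NormedPlane

variable {N : Seminorm ℝ (ℝ × ℝ)} {α : ℝ} {p : ℝ → ℝ × ℝ} {h g m u v : ℝ → ℝ} {lam mu κ : ℝ}

/-! ### Higher modes, points and completeness -/

section Modes

open L0Space
open scoped InnerProductSpace

theorem IsSolution.mem_L0_of_eigen (hW : RegularWeights p) (H : IsSolution p (lam • u) u m)
    (h0 : lam ≠ 0) : u ∈ L0 p := by
  have := (L0Submodule hW).smul_mem lam⁻¹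
    (H.mem_L0 hW (H.continuous.const_smul lam) (H.periodic.smul lam))
  rwa [inv_smul_smul₀ h0] at this

theorem solveL_eq (hW : RegularWeights p) {x : L0Space hW}
    (H : IsSolution p (lam • toFun x) (toFun x) m) (h0 : lam ≠ 0) : solveL hW x = lam⁻¹ • x := by
  apply toFun_injective
  have H' := H.smul lam⁻¹
  rw [inv_smul_smul₀ h0] at H'
  rw [toFun_solveL, map_smul]
  exact hW.S_eq x.mem H' ((L0Submodule hW).smul_mem _ x.mem)

theorem isSolution_of_solveL_eq (hW : RegularWeights p) {x : L0Space hW} (h0 : κ ≠ 0)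
    (hx : solveL hW x = κ • x) : ∃ m, IsSolution p (κ⁻¹ • toFun x) (toFun x) m := by
  have H := (hW.isSolution_S x.mem).smul κ⁻¹
  rw [← toFun_solveL, hx, map_smul, inv_smul_smul₀ h0] at H
  exact ⟨_, H⟩

/-- The eigenfunctions of index at least two, as vectors of `L₀`. -/
def higherModes (hW : RegularWeights p) : Set (L0Space hW) :=
  {x | ∃ k lam, 2 ≤ k ∧ IsMode p k lam (toFun x)}

theorem exists_solveL_eq_of_mem_higherModes (hp : IsUnitCircleParam N α p)
    {x : L0Space hp.regularWeights} (hx : x ∈ higherModes hp.regularWeights) :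
    ∃ k lam, 2 ≤ k ∧ 1 < lam ∧ IsMode p k lam (toFun x) ∧ solveL _ x = lam⁻¹ • x := by
  obtain ⟨k, lam, hk, hx⟩ := hx
  have h1 := one_lt_of_two_le_index hp hk hx
  exact ⟨k, lam, hk, h1, hx, solveL_eq _ (hx.isSolution hp.regularWeights) (by linarith)⟩

theorem span_modes_eq (hp : IsUnitCircleParam N α p) :
    Submodule.span ℝ {u | ∃ k lam, 2 ≤ k ∧ IsMode p k lam u} =
      (Submodule.span ℝ (higherModes hp.regularWeights)).map toFun := by
  rw [Submodule.map_span]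
  congr 1
  ext u
  constructor
  · rintro ⟨k, lam, hk, hu⟩
    have h1 := one_lt_of_two_le_index hp hk hu
    exact ⟨mk _ ((hu.isSolution hp.regularWeights).mem_L0_of_eigen hp.regularWeights (by linarith)),
      ⟨k, lam, hk, hu⟩, rfl⟩
  · rintro ⟨x, hx, rfl⟩
    exact hx

/-- `C0` measures approximation by the square of the norm, which accounts for `ε ^ 2` and `√ε` in
the two directions. -/
theorem toFun_mem_C0_iff (hp : IsUnitCircleParam N α p) (x : L0Space hp.regularWeights) :
    toFun x ∈ C0 p ↔ x ∈ closure (Submodule.span ℝ (higherModes hp.regularWeights) : Set _) := by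
  rw [C0, mem_ofPred_eq, span_modes_eq hp, Metric.mem_closure_iff, and_iff_right x.mem]
  have key : ∀ y, ip p (toFun x - toFun y) (toFun x - toFun y) = dist x y ^ 2 := fun y => by
    rw [dist_eq_norm, norm_sq_eq, map_sub]
  constructor
  · intro h ε hε
    obtain ⟨_, ⟨y, hy, rfl⟩, hlt⟩ := h (ε ^ 2) (by positivity)
    rw [key] at hlt
    exact ⟨y, hy, lt_of_pow_lt_pow_left₀ 2 hε.le hlt⟩
  · intro h ε hε
    obtain ⟨y, hy, hlt⟩ := h (√ε) (Real.sqrt_pos.2 hε)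
    refine ⟨toFun y, Submodule.mem_map_of_mem hy, ?_⟩
    rw [key]
    calc dist x y ^ 2 < √ε ^ 2 := pow_lt_pow_left₀ hlt dist_nonneg two_ne_zero
      _ = ε := Real.sq_sqrt hε.le

/-- The support functions of points. -/
def pointSupport (hp : IsUnitCircleParam N α p) : ℝ × ℝ →ₗ[ℝ] L0Space hp.regularWeights where
  toFun x := mk _ ((isSolution_det_dual hp x).mem_L0 hp.regularWeights
    (isSolution_det_dual hp x).continuous (isSolution_det_dual hp x).periodic)
  map_add' x y := toFun_injective (funext fun θ => by
    simp only [toFun_mk, map_add, Pi.add_apply, det, Prod.fst_add, Prod.snd_add]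
    ring)
  map_smul' c x := toFun_injective (funext fun θ => by
    simp only [toFun_mk, map_smul, Pi.smul_apply, det_smul_left, RingHom.id_apply, smul_eq_mul])

theorem toFun_pointSupport (hp : IsUnitCircleParam N α p) (x : ℝ × ℝ) :
    toFun (pointSupport hp x) = fun θ => det x (dual p θ) := rfl

theorem solveL_pointSupport (hp : IsUnitCircleParam N α p) (x : ℝ × ℝ) :
    solveL _ (pointSupport hp x) = (1 : ℝ) • pointSupport hp x := by
  have H := isSolution_det_dual hp x
  rw [← toFun_pointSupport] at H
  simpa using solveL_eq hp.regularWeights (lam := 1) (by simpa using H) one_ne_zero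

theorem pointSupport_injective (hp : IsUnitCircleParam N α p) :
    Function.Injective (pointSupport hp) := by
  refine (injective_iff_map_eq_zero _).2 fun x hx => ?_
  have H := isSolution_det_dual hp x
  have h1 : (fun θ => det x (dual p θ)) = 0 :=
    (toFun_pointSupport hp x).symm.trans (by rw [hx, map_zero])
  have h2 := H.flux_eq hp.regularWeights 0
  rw [h1] at h2
  simp only [Pi.zero_def, deriv_const, zero_div, neg_eq_zero] at h2
  have h3 : det x (dual p 0) = 0 := congrFun h1 0
  have h4 := eq_det_smul_sub_det_smul (hp.det_dual 0) x
  rwa [h2, h3, zero_smul, zero_smul, sub_zero] at h4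

theorem isOrtho_range_pointSupport (hp : IsUnitCircleParam N α p) :
    LinearMap.range (pointSupport hp) ⟂ Submodule.span ℝ (higherModes hp.regularWeights) := by
  rw [← Submodule.span_eq (LinearMap.range (pointSupport hp)), Submodule.isOrtho_span]
  rintro _ ⟨x, rfl⟩ y hy
  obtain ⟨k, lam, -, hlam, -, hy⟩ := exists_solveL_eq_of_mem_higherModes hp hy
  refine inner_eigenvectors_eq_zero (isSymmetric_solve (hW := hp.regularWeights)) ?_
    (solveL_pointSupport hp x) hy
  exact (inv_lt_one_of_one_lt₀ hlam).ne'

/-- Completeness of the eigenfunctions. -/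
theorem mem_closure_span_higherModes (hp : IsUnitCircleParam N α p) (y : L0Space hp.regularWeights)
    (hy : solveL _ y ∈ (LinearMap.range (pointSupport hp))ᗮ) :
    solveL _ y ∈ closure (Submodule.span ℝ (higherModes hp.regularWeights) : Set _) := by
  have hW := hp.regularWeights
  refine mem_closure_of_mem_closure_sup (isOrtho_range_pointSupport hp) ?_ hy
  refine closure_mono ?_ (apply_mem_closure_span_eigenvectors (S := solveL hp.regularWeights)
    isSymmetric_solve (isCompactOperator_solve _) y)
  refine Submodule.span_le.2 ?_
  rintro x ⟨κ, hκ, hx⟩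
  rcases eq_or_ne x 0 with rfl | hx0
  · exact zero_mem _
  obtain ⟨m, H⟩ := isSolution_of_solveL_eq _ hκ hx
  rcases eq_or_ne κ 1 with rfl | hκ1
  · rw [inv_one, one_smul] at H
    obtain ⟨v, hv⟩ := exists_eq_det_dual hp H
    exact Submodule.mem_sup_left ⟨v, toFun_injective hv.symm⟩
  · obtain ⟨k, hk⟩ := H.exists_isMode hW fun h => hx0 (toFun_injective (by rw [h, map_zero]))
    exact Submodule.mem_sup_right (Submodule.subset_span
      ⟨k, _, two_le_index hp hk (inv_ne_zero hκ) (by simpa using hκ1), hk⟩)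

/-- The point `v` is given by the orthogonal projection of `h` onto the support functions of points.
It is unique because these are orthogonal to the higher modes and determine their points. -/
theorem existsUnique_sub_mem_C0 (hp : IsUnitCircleParam N α p) (hh : h ∈ D0 p) :
    ∃! v : ℝ × ℝ, (fun θ => h θ - det v (dual p θ)) ∈ C0 p := by
  have hW := hp.regularWeights
  let x : L0Space hp.regularWeights := mk _ hh.1
  have hsub : ∀ v, (fun θ => h θ - det v (dual p θ)) = toFun (x - pointSupport hp v) := fun v => by
    rw [map_sub, toFun_pointSupport]
    rfl
  simp only [hsub, toFun_mem_C0_iff hp]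
  refine existsUnique_of_exists_of_unique ?_ fun v w hv hw => ?_
  · obtain ⟨v, hv⟩ := (LinearMap.range (pointSupport hp)).starProjection_apply_mem x
    refine ⟨v, ?_⟩
    have H := hW.isSolution_of_mem_D0 hh
    have hT : T p h ∈ L0 p := hW.bijOn_T.mapsTo hh
    -- Completeness is available only on the range of `S`. The difference lies there, since `h = S
    -- (T h)` and `S` fixes the support functions of points.
    have hx : solveL hp.regularWeights (mk _ hT - pointSupport hp v) = x - pointSupport hp v := by
      rw [map_sub, solveL_pointSupport, one_smul]
      congr 1
      exact toFun_injective (hW.S_eq hT H hh.1)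
    rw [← hx]
    refine mem_closure_span_higherModes hp _ ?_
    rw [hx, hv]
    exact Submodule.sub_starProjection_mem_orthogonal x
  · rw [← Submodule.topologicalClosure_coe] at hv hw
    have h1 := Submodule.sub_mem _ hw hv
    rw [sub_sub_sub_cancel_left, ← map_sub] at h1
    have h2 : pointSupport hp (v - w) ∈ (LinearMap.range (pointSupport hp))ᗮ := by
      refine Submodule.topologicalClosure_minimal _ ?_ (Submodule.isClosed_orthogonal _) h1
      exact (isOrtho_range_pointSupport hp).symm
    have h3 : pointSupport hp (v - w) = 0 :=
      inner_self_eq_zero (𝕜 := ℝ).1 (h2 _ (LinearMap.mem_range_self _ _))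
    exact sub_eq_zero.1 ((map_eq_zero_iff _ (pointSupport_injective hp)).1 h3)

end Modes

/-! ### Curves, evolutes and support functions -/

section Curves

/-- Along `g p + m q` the frame equations leave `(g - h) p'`, so `r = g - h` and the evolute is `h p
+ m q`. Its derivative is `s q'` with `s = m - h' / [q, q']`, and subtracting `s q` leaves the curve
of `h`. -/
theorem IsSolution.isDoubleEvolute (hp : IsUnitCircleParam N α p) (H : IsSolution p h g m)
    (hh : Differentiable ℝ h) : IsDoubleEvolute p (curveOf p g) (curveOf p h) := by
  have hW := hp.regularWeights
  have hγ : curveOf p g = fun t => g t • p t + m t • dual p t :=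
    funext fun t => by rw [curveOf, H.flux_eq hW]
  have hp' := fun θ => (hp.hasDerivAt θ).congr_deriv (hp.deriv_eq θ)
  have hδ : (fun t => curveOf p g t - (g t - h t) • p t) =
      fun t => h t • p t + m t • dual p t := by
    funext t
    rw [hγ]
    module
  refine ⟨fun t => g t - h t, fun t => m t - deriv h t / dualWt p t, fun θ => ?_, fun θ => ?_,
    fun θ => ?_⟩
  · rw [hγ, hp.deriv_eq]
    refine (((H.hasDerivAt θ).smul (hp' θ)).add
      ((H.hasDerivAt_flux θ).smul (hp.hasDerivAt_dual θ))).congr_deriv ?_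
    module
  · rw [hδ, hp.deriv_dual]
    refine (((hh θ).hasDerivAt.smul (hp' θ)).add
      ((H.hasDerivAt_flux θ).smul (hp.hasDerivAt_dual θ))).congr_deriv ?_
    have h1 : (m θ - deriv h θ / dualWt p θ) • -dualWt p θ • p θ =
        (deriv h θ - dualWt p θ * m θ) • p θ := by
      rw [smul_smul]
      congr 1
      have := (hW.dualWt_pos θ).ne'
      field_simp
      ring
    rw [h1]
    module
  · rw [hγ, curveOf]
    module

theorem IsHedgehog.hasDerivAt_support (hp : IsUnitCircleParam N α p) {γ : ℝ → ℝ × ℝ}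
    (hγ : IsHedgehog p γ) (θ : ℝ) :
    HasDerivAt (support p γ) (dualWt p θ * -det (γ θ) (p θ)) θ := by
  have hd := (hγ.smooth.differentiable (by simp) θ).hasDerivAt
  refine (HasDerivAt.det hd (hp.hasDerivAt_dual θ)).congr_deriv ?_
  have h1 : det (deriv γ θ) (dual p θ) = 0 := by
    rw [dual, det_smul_right, hγ.tangent, mul_zero]
  rw [h1, det_smul_right]
  ring

/-- A closed curve is the curve of its support function. -/
theorem IsHedgehog.curveOf_support (hp : IsUnitCircleParam N α p) {γ : ℝ → ℝ × ℝ}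
    (hγ : IsHedgehog p γ) : curveOf p (support p γ) = γ := by
  funext θ
  rw [curveOf, (hγ.hasDerivAt_support hp θ).deriv, mul_div_cancel_left₀ _ (hp.dualWt_pos θ).ne']
  conv_rhs => rw [eq_det_smul_sub_det_smul (hp.det_dual θ) (γ θ)]
  rw [support, neg_smul, sub_eq_add_neg]

/-- The weighted mean of the support function is the dual length. -/
theorem IsHedgehog.support_mem_D0 (hp : IsUnitCircleParam N α p) {γ : ℝ → ℝ × ℝ}
    (hγ : IsHedgehog p γ) (h0 : dualLength p γ = 0) : support p γ ∈ D0 p := by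
  have hsm : ContDiff ℝ (⊤ : ℕ∞) (support p γ) := ContDiff.det hγ.smooth hp.contDiff_dual
  have hq := hp.dual_antiperiodic.periodic_two_mul
  refine ⟨⟨hsm.continuous, fun θ => by simp only [support, hγ.closed θ, hq θ], ?_⟩,
    by exact_mod_cast contDiff_infty.1 hsm 2⟩
  have hd := fun θ => (hγ.smooth.differentiable (by simp) θ).hasDerivAt
  have hcd : Continuous (deriv γ) := ((contDiff_infty_iff_deriv (𝕜 := ℝ)).1 hγ.smooth).2.continuous
  have hm : ∀ θ, HasDerivAt (fun t => det (p t) (γ t))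
      (det (p θ) (deriv γ θ) - support p γ θ * wt p θ) θ := fun θ => by
    refine (HasDerivAt.det (hp.hasDerivAt θ) (hd θ)).congr_deriv ?_
    rw [hp.deriv_eq, det_smul_left, support, det_swap (dual p θ)]
    ring
  have hc1 : Continuous fun θ => det (p θ) (deriv γ θ) := by
    have h1 := hp.smooth.continuous
    unfold det
    fun_prop
  have hc2 : Continuous fun θ => support p γ θ * wt p θ :=
    hsm.continuous.mul hp.contDiff_wt.continuous
  have h1 := intervalIntegral.integral_eq_sub_of_hasDerivAt
    (fun t (_ : t ∈ uIcc 0 (2 * π)) => hm t) ((hc1.sub hc2).intervalIntegrable _ _)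
  have hpp : Function.Periodic p (2 * π) :=
    Function.Antiperiodic.periodic_two_mul hp.antiperiodic
  have h2 : p (2 * π) = p 0 := by simpa using hpp 0
  have h3 : γ (2 * π) = γ 0 := by simpa using hγ.closed 0
  rw [h2, h3, sub_self, intervalIntegral.integral_sub (hc1.intervalIntegrable _ _)
    (hc2.intervalIntegrable _ _)] at h1
  rw [dualLength] at h0
  linarith

theorem curveOf_smul_sub (p : ℝ → ℝ × ℝ) (c : ℝ) (hg : Differentiable ℝ g)
    (hu : Differentiable ℝ u) (θ : ℝ) :
    curveOf p (c • g - u) θ = c • curveOf p g θ - curveOf p u θ := by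
  have : deriv (c • g - u) θ = c * deriv g θ - deriv u θ :=
    (((hg θ).hasDerivAt.const_smul c).sub (hu θ).hasDerivAt).deriv
  rw [curveOf, this, curveOf, curveOf, sub_div, mul_div_assoc]
  simp only [Pi.sub_apply, Pi.smul_apply, smul_eq_mul]
  module

theorem curveOf_smul (p : ℝ → ℝ × ℝ) (c : ℝ) (hg : Differentiable ℝ g) :
    curveOf p (c • g) = c • curveOf p g := by
  funext θ
  have : deriv (c • g) θ = c * deriv g θ := ((hg θ).hasDerivAt.const_smul c).deriv
  rw [Pi.smul_apply, curveOf, this, curveOf, mul_div_assoc]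
  simp only [Pi.smul_apply, smul_eq_mul]
  module

theorem exists_norm_curveOf_le (hp : IsUnitCircleParam N α p) :
    ∃ C, 0 ≤ C ∧ ∀ (g : ℝ → ℝ) (b θ : ℝ), |g θ| ≤ b → |deriv g θ / dualWt p θ| ≤ b →
      ‖curveOf p g θ‖ ≤ C * b := by
  have hpp : Function.Periodic p (2 * π) :=
    Function.Antiperiodic.periodic_two_mul hp.antiperiodic
  have hq := hp.dual_antiperiodic.periodic_two_mul
  obtain ⟨C₁, hC₁, h1⟩ := exists_forall_abs_le_of_periodic hp.smooth.continuous.norm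
    two_pi_pos.ne' (fun θ => by simp only [hpp θ])
  obtain ⟨C₂, hC₂, h2⟩ := exists_forall_abs_le_of_periodic hp.contDiff_dual.continuous.norm
    two_pi_pos.ne' (fun θ => by simp only [hq θ])
  simp only [abs_norm] at h1 h2
  refine ⟨C₁ + C₂, by positivity, fun g b θ hg hd => ?_⟩
  have hb : 0 ≤ b := (abs_nonneg _).trans hg
  rw [curveOf]
  refine (norm_add_le _ _).trans ?_
  rw [norm_smul, norm_smul, Real.norm_eq_abs, Real.norm_eq_abs]
  have e1 := mul_le_mul hg (h1 θ) (norm_nonneg _) hb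
  have e2 := mul_le_mul hd (h2 θ) (norm_nonneg _) hb
  linarith

end Curves

/-! ### Two criteria for uniform convergence -/

section UniformConvergence

variable {X V : Type*} [NormedAddCommGroup V] {F : ℕ → X → V} {f : X → V}

/-- The shift of the index reflects the smoothing: the norm at stage `n` controls uniformly only the
next iterate. -/
theorem tendstoUniformly_of_norm_sub_le {b : ℕ → ℝ} (hb : Tendsto b atTop (𝓝 0))
    (h : ∀ n x, ‖F (n + 1) x - f x‖ ≤ b n) : TendstoUniformly F f atTop := by
  rw [Metric.tendstoUniformly_iff]
  intro ε hε
  obtain ⟨n₀, hn₀⟩ := eventually_atTop.1 (hb.eventually_lt_const hε)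
  refine eventually_atTop.2 ⟨n₀ + 1, fun n hn x => ?_⟩
  obtain ⟨k, rfl⟩ := Nat.exists_eq_add_of_le' (Nat.le_of_lt hn)
  obtain ⟨j, rfl⟩ : ∃ j, k = j + 1 := Nat.exists_eq_succ_of_ne_zero (by rintro rfl; omega)
  rw [dist_comm, dist_eq_norm, show j + 1 + n₀ = (j + n₀) + 1 by ring]
  exact (h _ x).trans_lt (hn₀ _ (Nat.le_add_left _ _))

theorem tendstoUniformly_zero_of_pow_smul [NormedSpace ℝ V]
    (hF : TendstoUniformly (fun n => lam ^ n • F n) f atTop) (hlam : 1 < lam) {C : ℝ}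
    (hC : ∀ x, ‖f x‖ ≤ C) : TendstoUniformly F 0 atTop := by
  rw [Metric.tendstoUniformly_iff] at hF ⊢
  intro ε hε
  have h0 : 0 < lam := by linarith
  have hlim : Tendsto (fun n : ℕ => lam⁻¹ ^ n * (C + 1)) atTop (𝓝 0) := by
    simpa using (tendsto_pow_atTop_nhds_zero_of_lt_one (inv_nonneg.2 h0.le)
      (inv_lt_one_of_one_lt₀ hlam)).mul_const (C + 1)
  filter_upwards [hF 1 one_pos, hlim.eventually_lt_const hε] with n h1 h2 x
  refine lt_of_le_of_lt ?_ h2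
  have h3 := h1 x
  rw [dist_comm, dist_eq_norm] at h3
  have h4 : ‖lam ^ n • F n x‖ ≤ C + 1 := by
    have := norm_le_norm_add_norm_sub' (lam ^ n • F n x) (f x)
    have h5 := hC x
    change ‖lam ^ n • F n x - f x‖ < 1 at h3
    linarith
  rw [norm_smul, norm_pow, Real.norm_of_nonneg h0.le] at h4
  rw [Pi.zero_apply, dist_zero_left, inv_pow, inv_mul_eq_div, le_div_iff₀' (by positivity)]
  exact h4

end UniformConvergence

end NormedPlane

namespace NormedPlane

variable {N : Seminorm ℝ (ℝ × ℝ)} {α : ℝ} {p : ℝ → ℝ × ℝ} {h g m u v : ℝ → ℝ} {lam mu κ : ℝ}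

/-! ### Convergence of the iterated involutes -/

section Iteration

open L0Space
open scoped InnerProductSpace

theorem IsSolution.exists_norm_curveOf_le (hp : IsUnitCircleParam N α p) (H : IsSolution p h g m) :
    ∃ C, ∀ θ, ‖curveOf p g θ‖ ≤ C := by
  have hW := hp.regularWeights
  obtain ⟨C, -, hC⟩ := NormedPlane.exists_norm_curveOf_le hp
  obtain ⟨C₁, -, h1⟩ := exists_forall_abs_le_of_periodic H.continuous two_pi_pos.ne' H.periodic
  obtain ⟨C₂, -, h2⟩ := exists_forall_abs_le_of_periodic H.continuous_flux two_pi_pos.ne'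
    (H.flux_periodic hW)
  refine ⟨C * max C₁ C₂, fun θ => hC g _ θ ((h1 θ).trans (le_max_left _ _)) ?_⟩
  rw [← H.flux_eq hW]
  exact (h2 θ).trans (le_max_right _ _)

/-- If the rescaled iterates of `S` converge in the norm of `L₀`, then they and their curves
converge uniformly. -/
theorem tendstoUniformly_of_tendsto (hp : IsUnitCircleParam N α p)
    {x y : L0Space hp.regularWeights} (hlam : lam ≠ 0) (hy : solveL _ y = lam⁻¹ • y)
    (hlim : Tendsto (fun n : ℕ => lam ^ n • (solveL _ ^ n) (x - y)) atTop (𝓝 0)) :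
    TendstoUniformly (fun n : ℕ => lam ^ n • (S p)^[n] (toFun x)) (toFun y) atTop ∧
    TendstoUniformly (fun n : ℕ => lam ^ n • curveOf p ((S p)^[n] (toFun x)))
      (curveOf p (toFun y)) atTop := by
  have hW := hp.regularWeights
  set d : ℕ → L0Space hp.regularWeights := fun n => lam ^ n • (solveL _ ^ n) (x - y)
  have hpow : ∀ n : ℕ, lam ^ n • (solveL hp.regularWeights ^ n) y = y := fun n => by
    induction n with
    | zero => simp
    | succ n ih =>
      have h1 : (solveL hp.regularWeights ^ (n + 1)) y = lam⁻¹ • (solveL _ ^ n) y := by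
        rw [pow_succ, ← map_smul, ← hy]
        rfl
      rw [h1, smul_smul, pow_succ, mul_assoc, mul_inv_cancel₀ hlam, mul_one, ih]
  have hd : ∀ n, lam ^ n • (S p)^[n] (toFun x) - toFun y = toFun (d n) := fun n => by
    rw [← toFun_solveL_pow, ← map_smul toFun, ← map_sub toFun]
    congr 1
    change _ = lam ^ n • (solveL hp.regularWeights ^ n) (x - y)
    rw [map_sub, smul_sub, hpow]
  -- The error at stage `n + 1` is `S` of `lam` times the error at stage `n`, so its values and its
  -- flux are uniformly bounded by the norm of the latter.
  have hsucc : ∀ n, toFun (d (n + 1)) = S p (toFun (lam • d n)) := fun n => by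
    rw [← toFun_solveL]
    congr 1
    change lam ^ (n + 1) • (solveL hp.regularWeights ^ (n + 1)) (x - y) =
      solveL _ (lam • lam ^ n • (solveL _ ^ n) (x - y))
    rw [map_smul, map_smul, smul_smul, ← pow_succ', pow_succ' (solveL hp.regularWeights)]
    rfl
  obtain ⟨C, hC0, hC⟩ := exists_norm_curveOf_le hp
  let B := max (solveBound p) (fluxBound p)
  have hlim' : Tendsto (fun n => B * ‖lam • d n‖) atTop (𝓝 0) := by
    have := (hlim.const_smul lam).norm.const_mul B
    simpa using this
  have hB1 : ∀ n θ, |S p (toFun (lam • d n)) θ| ≤ B * ‖lam • d n‖ := fun n θ =>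
    (abs_solve_le _ θ).trans (mul_le_mul_of_nonneg_right (le_max_left _ _) (norm_nonneg _))
  have hB2 : ∀ n θ, |deriv (S p (toFun (lam • d n))) θ / dualWt p θ| ≤ B * ‖lam • d n‖ :=
    fun n θ => (abs_flux_solve_le _ θ).trans
      (mul_le_mul_of_nonneg_right (le_max_right _ _) (norm_nonneg _))
  have hdx : ∀ n, Differentiable ℝ ((S p)^[n + 1] (toFun x)) := fun n => by
    rw [Function.iterate_succ_apply', ← toFun_solveL_pow]
    exact (hW.S_mem (mem _)).2.differentiable (by norm_num)
  have hdy : Differentiable ℝ (toFun y) := by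
    have h1 : toFun y = lam • S p (toFun y) := by
      rw [← toFun_solveL, hy, map_smul, smul_inv_smul₀ hlam]
    rw [h1]
    exact ((hW.S_mem y.mem).2.differentiable (by norm_num)).const_smul lam
  refine ⟨tendstoUniformly_of_norm_sub_le hlim' fun n θ => ?_,
    tendstoUniformly_of_norm_sub_le (by simpa using hlim'.const_mul C) fun n θ => ?_⟩
  · have h1 := congrFun (hd (n + 1)) θ
    rw [Pi.sub_apply] at h1
    rw [h1, hsucc]
    exact hB1 n θ
  · rw [Pi.smul_apply, ← curveOf_smul_sub p _ (hdx n) hdy, hd, hsucc]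
    exact hC _ _ θ (hB1 n θ) (hB2 n θ)

theorem exists_dominant_mode (hp : IsUnitCircleParam N α p) (hh : h ∈ C0 p) (h0 : h ≠ 0) :
    ∃ (k : ℕ) (lam : ℝ) (u : ℝ → ℝ), 2 ≤ k ∧ IsMode p k lam u ∧
      (∀ (j : ℕ) (v : ℝ → ℝ), IsMode p j lam v → ip p (h - u) v = 0) ∧
      (∀ (j : ℕ) (mu : ℝ) (v : ℝ → ℝ), IsMode p j mu v → ip p h v ≠ 0 → k ≤ j ∧ lam ≤ mu) ∧
      IsDoubleEvolute p (curveOf p u) (lam • curveOf p u) ∧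
      TendstoUniformly (fun n : ℕ => lam ^ n • (S p)^[n] h) u atTop ∧
      TendstoUniformly (fun n : ℕ => lam ^ n • curveOf p ((S p)^[n] h)) (curveOf p u) atTop := by
  have hW := hp.regularWeights
  obtain ⟨x, rfl⟩ : ∃ x : L0Space hp.regularWeights, toFun x = h := ⟨mk _ hh.1, rfl⟩
  have hx := (toFun_mem_C0_iff hp x).1 hh
  have hx0 : x ≠ 0 := by
    rintro rfl
    exact h0 (map_zero _)
  obtain ⟨κ, y, hκ, hy0, hy, ⟨a, ha, hκa⟩, hproj, hmax, hlim⟩ :=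
    exists_dominant_eigenvector (S := solveL hp.regularWeights) isSymmetric_solve
      (isCompactOperator_solve _) (G := higherModes hp.regularWeights) (fun a ha => by
        obtain ⟨k, lam, -, hlam, -, h⟩ := exists_solveL_eq_of_mem_higherModes hp ha
        exact ⟨lam⁻¹, inv_pos.2 (by linarith), h⟩) hx0 hx
  obtain ⟨k, lam, hk, hlam, hmode, hSa⟩ := exists_solveL_eq_of_mem_higherModes hp ha
  have ha0 : a ≠ 0 := by
    rintro rfl
    exact hmode.ne_zero (map_zero _)
  obtain rfl : κ = lam⁻¹ := smul_left_injective ℝ ha0 (hκa.symm.trans hSa)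
  have hlam0 : lam ≠ 0 := by linarith
  obtain ⟨m, H⟩ := isSolution_of_solveL_eq _ hκ.ne' hy
  rw [inv_inv] at H
  have hfy0 : toFun y ≠ 0 := fun h => hy0 (toFun_injective (by rw [h, map_zero]))
  -- The projection `y` lies in the eigenspace of the higher mode `a`, and the index is constant on
  -- an eigenspace.
  have hymode : IsMode p k lam (toFun y) := H.isMode hW hfy0
    ((H.zeroCount_eq hW hfy0 (hmode.isSolution hW) hmode.ne_zero).trans hmode.index)
  rw [inv_inv] at hlim
  have hdiff : Differentiable ℝ (toFun y) := fun θ => (H.hasDerivAt θ).differentiableAt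
  refine ⟨k, lam, toFun y, hk, hymode, fun j v hv => ?_, fun j mu v hv hne => ?_, ?_,
    tendstoUniformly_of_tendsto hp hlam0 hy hlim⟩
  · have Hv := hv.isSolution hW
    have hmem := Hv.mem_L0_of_eigen hW hlam0
    have h1 := hproj (mk _ hmem) (solveL_eq _ Hv hlam0)
    rwa [inner_eq, map_sub] at h1
  · have Hv := hv.isSolution hW
    have hmu0 : mu ≠ 0 := by
      rintro rfl
      obtain ⟨c, rfl⟩ := Hv.eq_const_of_eigenvalue_zero hW
      refine hne ?_
      simp only [ip, mul_right_comm _ c]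
      rw [intervalIntegral.integral_mul_const, hh.1.2.2, zero_mul]
    have hle : mu⁻¹ ≤ lam⁻¹ :=
      hmax _ (mk _ (Hv.mem_L0_of_eigen hW hmu0)) (solveL_eq _ Hv hmu0) hne
    -- Excluding 0 and 1 forces index at least two, hence `mu > 1`. Only then can the inequality
    -- between inverses be turned into `lam ≤ mu`.
    have hmu1 : mu ≠ 1 := by
      rintro rfl
      rw [inv_one] at hle
      exact absurd (inv_lt_one_of_one_lt₀ hlam) (not_lt.2 hle)
    have hmu := one_lt_of_two_le_index hp (two_le_index hp hv hmu0 hmu1) hv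
    have hlm : lam ≤ mu := (inv_le_inv₀ (by linarith) (by linarith)).1 hle
    refine ⟨?_, hlm⟩
    have h1 := IsSolution.zeroCount_le hW (hymode.isSolution hW) Hv hlm hfy0
    have h2 : (2 * k : ℕ∞) ≤ 2 * j := by
      rw [← hymode.index, ← hv.index]
      exact h1
    have h3 : 2 * k ≤ 2 * j := by exact_mod_cast h2
    omega
  · rw [← curveOf_smul p lam hdiff]
    exact H.isDoubleEvolute hp (hdiff.const_smul lam)

theorem tendstoUniformly_iterate (hp : IsUnitCircleParam N α p) (hh : h ∈ C0 p) :
    TendstoUniformly (fun n : ℕ => (S p)^[n] h) 0 atTop ∧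
      TendstoUniformly (fun n : ℕ => curveOf p ((S p)^[n] h)) 0 atTop := by
  have hW := hp.regularWeights
  rcases eq_or_ne h 0 with rfl | h0
  · have h1 : ∀ n, (S p)^[n] 0 = 0 := fun n => by
      have := toFun_solveL_pow (0 : L0Space hp.regularWeights) n
      rw [map_zero, map_zero] at this
      exact this.symm
    have h2 : curveOf p 0 = 0 := by
      funext θ
      simp [curveOf, Pi.zero_def]
    simp only [h1, h2]
    exact ⟨fun s hs => Eventually.of_forall fun _ _ => refl_mem_uniformity hs,
      fun s hs => Eventually.of_forall fun _ _ => refl_mem_uniformity hs⟩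
  · obtain ⟨k, lam, u, hk, hu, -, -, -, h1, h2⟩ := exists_dominant_mode hp hh h0
    have hlam := one_lt_of_two_le_index hp hk hu
    have H := hu.isSolution hW
    obtain ⟨C₁, -, hC₁⟩ := exists_forall_abs_le_of_periodic H.continuous two_pi_pos.ne' H.periodic
    obtain ⟨C₂, hC₂⟩ := H.exists_norm_curveOf_le hp
    exact ⟨tendstoUniformly_zero_of_pow_smul h1 hlam hC₁,
      tendstoUniformly_zero_of_pow_smul h2 hlam hC₂⟩

end Iteration

end NormedPlane

end

theorem mainTheorem10 (N : Seminorm ℝ (ℝ × ℝ)) (α : ℝ) (p : ℝ → ℝ × ℝ)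
    (hp : NormedPlane.IsUnitCircleParam N α p) :
    -- `S` is the inverse of `T`, and it is the involute operator on support functions
    BijOn (NormedPlane.T p) (NormedPlane.D0 p) (NormedPlane.L0 p) ∧
    (∀ h ∈ NormedPlane.L0 p, ContDiff ℝ 1 h →
      NormedPlane.IsDoubleEvolute p
        (NormedPlane.curveOf p (NormedPlane.S p h)) (NormedPlane.curveOf p h)) ∧
    -- a closed curve is determined by its support function, which lies in `C₀` after a unique
    -- translation if the dual length is zero
    (∀ γ : ℝ → ℝ × ℝ, NormedPlane.IsHedgehog p γ →
      NormedPlane.curveOf p (NormedPlane.support p γ) = γ ∧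
      (NormedPlane.dualLength p γ = 0 →
        ∃! v : ℝ × ℝ, NormedPlane.support p (fun θ => γ θ - v) ∈ NormedPlane.C0 p)) ∧
    -- the relevant eigenvalues exceed one
    (∀ (k : ℕ) (lam : ℝ) (u : ℝ → ℝ), 2 ≤ k → NormedPlane.IsMode p k lam u → 1 < lam) ∧
    -- the iterated involutes converge to zero
    (∀ h ∈ NormedPlane.C0 p,
      TendstoUniformly (fun n : ℕ => (NormedPlane.S p)^[n] h) 0 atTop ∧
      TendstoUniformly (fun n : ℕ => NormedPlane.curveOf p ((NormedPlane.S p)^[n] h)) 0 atTop) ∧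
    -- after rescaling they converge to the cycloid of the lowest nonzero mode
    (∀ h ∈ NormedPlane.C0 p, h ≠ 0 →
      ∃ (k : ℕ) (lam : ℝ) (u : ℝ → ℝ), 2 ≤ k ∧ NormedPlane.IsMode p k lam u ∧
        (∀ (j : ℕ) (v : ℝ → ℝ), NormedPlane.IsMode p j lam v → NormedPlane.ip p (h - u) v = 0) ∧
        (∀ (j : ℕ) (mu : ℝ) (v : ℝ → ℝ), NormedPlane.IsMode p j mu v →
          NormedPlane.ip p h v ≠ 0 → k ≤ j ∧ lam ≤ mu) ∧
        NormedPlane.IsDoubleEvolute p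
          (NormedPlane.curveOf p u) (lam • NormedPlane.curveOf p u) ∧
        TendstoUniformly (fun n : ℕ => lam ^ n • (NormedPlane.S p)^[n] h) u atTop ∧
        TendstoUniformly
          (fun n : ℕ => lam ^ n • NormedPlane.curveOf p ((NormedPlane.S p)^[n] h))
          (NormedPlane.curveOf p u) atTop) := by
  have hW := hp.regularWeights
  refine ⟨hW.bijOn_T, fun h hh hd => ?_, fun γ hγ => ⟨hγ.curveOf_support hp, fun h0 => ?_⟩,
    fun k lam u hk hu => NormedPlane.one_lt_of_two_le_index hp hk hu,
    fun h hh => NormedPlane.tendstoUniformly_iterate hp hh,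
    fun h hh h0 => NormedPlane.exists_dominant_mode hp hh h0⟩
  · exact (hW.isSolution_S hh).isDoubleEvolute hp (hd.differentiable (by norm_num))
  · have hsub : ∀ v, NormedPlane.support p (fun θ => γ θ - v) =
        fun θ => NormedPlane.support p γ θ - NormedPlane.det v (NormedPlane.dual p θ) :=
      fun v => funext fun θ => NormedPlane.det_sub_left _ _ _
    simpa only [hsub] using NormedPlane.existsUnique_sub_mem_C0 hp (hγ.support_mem_D0 hp h0)
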